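/- All semigroups and categories below are nonempty and small. **Semigroups.** A *DRC-restriction semigroup* is $(S,\cdot,{}^+,{}^*)$, where $(S,\cdot)$ is a semigroup and for all $x,y\in S$: $x^+x=x$, $(xy)^+=(xy^+)^+$, $(xy)^+=x^+(xy)^+x^+$, $x^{++}=x^+$, $x^{+*}=x^+$, $xx^*=x$, $(xy)^*=(x^*y)^*$, $(xy)^*=y^*(xy)^*y^*$, $x^{**}=x^*$, $x^{*+}=x^*$, $x(yx)^*=(yx^+)^*x$ and $(xy)^+x=x(x^*y)^+$; put $P(S)=\{x^+\mid x\in S\}$. A *$P$-restriction semigroup* is $(S,\cdot,{}^+,{}^*)$ with $x^+x=x$, $(xy)^+=(xy^+)^+$, $(x^+y^+)^+=x^+y^+x^+$, $x^+x^+=x^+$, $x^{+*}=x^+$, $xx^*=x$, $(xy)^*=(x^*y)^*$, $(x^*y^*)^*=y^*x^*y^*$, $x^*x^*=x^*$, $x^{*+}=x^*$, $(xy)^+x=xy^+x^*$, $x(yx)^*=x^+y^*x$. A *restriction semigroup* is $(S,\cdot,{}^+,{}^*)$ with $x^+x=x$, $x^+y^+=y^+x^+=(x^+y^+)^+$, $x^+(xy)^+=(xy)^+=(xy^+)^+$,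 $x^{+*}=x^+$, $xx^*=x$, $x^*y^*=y^*x^*=(x^*y^*)^*$, $(xy)^*y^*=(xy)^*=(x^*y)^*$, $x^{*+}=x^*$, $(xy)^+x=xy^+$, $x(yx)^*=y^*x$. A *generalized regular $\circ$-semigroup* is $(S,\cdot,{}^\circ)$ with $xx^\circ x=x$, $x^{\circ\circ}=x$, $(xy)^\circ=(xy)^\circ xx^\circ=y^\circ y(xy)^\circ$, $(xy)^\circ x=(x^\circ xy)^\circ$; a *regular $\circ$-semigroup* is $(S,\cdot,{}^\circ)$ with $xx^\circ x=x$, $x^{\circ\circ}=x$, $(xy)^\circ=y^\circ x^\circ$; an *inverse semigroup* is a regular semigroup whose idempotents commute, and there $x^\circ$ denotes the unique inverse of $x$. In the last three cases put $x^+=xx^\circ$, $x^*=x^\circ x$. Each of these five classes thus consists of DRC-restriction semigroups with, possibly, additional structure. A *(2,1,1)-homomorphism* is a map preserving $\cdot$, ${}^+$ and ${}^*$. **Projection algebras.** A *strong projection algebra* is $(P,\times,\star)$ with $e\times e=e$, $(e\times f)\times e=e\times f$, $e\times(f\times g)=(e\times f)\times(f\times g)$, $(e\times f)\times g=(e\times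 f)\times(e\times g)$, the four left-right dual identities for $\star$, namely $e\star e=e$, $e\star(f\star e)=f\star e$, $(g\star f)\star e=(g\star f)\star(f\star e)$, $g\star(f\star e)=(g\star e)\star(f\star e)$, and $(e\star(f\times g))\star g=(e\star f)\star g$, $g\times((g\star f)\times e)=g\times(f\times e)$, $(e\times f)\star e=e\times f$, $f\times(e\star f)=e\star f$, $e\times(((e\times f)\times g)\star f)=(e\times f)\times g$, $(f\times(g\star(f\star e)))\star e=g\star(f\star e)$. Write $e\le_P f$ if $e=f\times e$, and $p\,\mathcal F\,q$ if $p\times q=p$ and $p\star q=q$. $P$ is *symmetric* if $e\times f=f\star e$, and *commutative* if $e\times f=f\times e$, for all $e,f$. A *path* is a sequence $(p_1,\dots,p_k)$, $k\ge1$, with $p_1\,\mathcal F\,p_2\,\mathcal F\cdots\mathcal F\,p_k$; paths $\mathfrak p,\mathfrak q$ with $p_k=q_1$ compose to $\mathfrak p\circ\mathfrak q=(p_1,\dots,p_k,q_2,\dots,q_l)$. Write $\mathfrak p\le\mathfrak q$ if there is $r\le_P q_1$ with $\mathfrak p=(r_1,\dots,r_k)$, where $r_1=r$ and $r_i=r_{i-1}\star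 q_i$. **Chain projection ordered categories.** View a small category as its set $C$ of arrows with the partial composition $\circ$ and the maps $\mathbf d,\mathbf r:C\to C$ giving the source and target identities, so that $a\circ b$ is defined iff $\mathbf r(a)=\mathbf d(b)$; let $P_C=\mathbf d(C)$. It is *ordered* by a partial order $\le$ on $C$ if $a\le b$ implies $\mathbf d(a)\le\mathbf d(b)$ and $\mathbf r(a)\le\mathbf r(b)$; $a\le b$, $c\le d$ imply $a\circ c\le b\circ d$ when both are defined; for $P_C\ni p\le\mathbf d(a)$ there is a unique ${}_p{\downharpoonleft}a\le a$ with source $p$; and for $P_C\ni q\le\mathbf r(a)$ there is a unique $a{\downharpoonright}_q\le a$ with target $q$. It is a *projection ordered category* if moreover $P_C$ is given the structure of a strong projection algebra, $\le$ restricts to $\le_{P_C}$ on $P_C$, and for all $a\in C$, $p,t\in P_C$ $$(p\Theta_a)\times t=(p\times t\Delta_a)\Theta_a,\qquad t\star(p\Delta_a)=(t\Theta_a\star p)\Delta_a,$$ where $x\Theta_a=\mathbf r({}_{x\star\mathbf d(a)}{\downharpoonleft}a)$ and $y\Delta_a=\mathbf d(a{\downharpoonright}_{\mathbf r(a)\times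 y})$. It is a *chain projection ordered category* if it is moreover given a map $\varepsilon$ from the paths in $P_C$ to $C$ with $\varepsilon(p)=\varepsilon(p,p)=p$; $\mathbf d(\varepsilon(\mathfrak p))=p_1$, $\mathbf r(\varepsilon(\mathfrak p))=p_k$; $\varepsilon(\mathfrak p\circ\mathfrak q)=\varepsilon(\mathfrak p)\circ\varepsilon(\mathfrak q)$; $\mathfrak p\le\mathfrak q\Rightarrow\varepsilon(\mathfrak p)\le\varepsilon(\mathfrak q)$; such that for all $b\in C$ and all $e,f\in P_C$ with $f=e\Theta_b\star f$ and $e=e\times f\Delta_b$, $$\varepsilon(e,e_1)\circ{}_{e_1}{\downharpoonleft}b\circ\varepsilon(f_1,f)=\varepsilon(e,e_2)\circ b{\downharpoonright}_{f_2}\circ\varepsilon(f_2,f),$$ where $e_1=e\star\mathbf d(b)$, $f_1=e\Theta_b$, $e_2=f\Delta_b$, $f_2=\mathbf r(b)\times f$. It is *symmetric* if $P_C$ is symmetric and $\varepsilon(p,q,p)=p$ whenever $p\,\mathcal F\,q$; *commutative* if $P_C$ is commutative; and a *chain projection ordered groupoid* if every arrow is invertible. A *chain projection ordered functor* is a map $\phi$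 between the arrow sets that preserves $\mathbf d$, $\mathbf r$, $\circ$, $\le$, the operations $\times,\star$ on objects, and $\varepsilon$ (i.e. $\varepsilon(p_1,\dots,p_k)\phi=\varepsilon(p_1\phi,\dots,p_k\phi)$). **Theorem.** There are mutually inverse functors $\mathbf C$ and $\mathbf S$ between the category of DRC-restriction semigroups with (2,1,1)-homomorphisms and the category of chain projection ordered categories with chain projection ordered functors. Both leave underlying sets and maps unchanged. $\mathbf C(S)$ has $\mathbf d(x)=x^+$, $\mathbf r(x)=x^*$, $x\circ y=xy$ if $x^*=y^+$, $x\le y$ iff $x=x^+y$ and $y^+x^+y^+=x^+$, $e\times f=(ef)^+$, $e\star f=(ef)^*$ and $\varepsilon(p_1,\dots,p_k)=p_1\cdots p_k$; $\mathbf S(C)$ has the product $a\bullet b=a{\downharpoonright}_{p}\circ\varepsilon(p,q)\circ{}_{q}{\downharpoonleft}b$ with $p=\mathbf r(a)\times\mathbf d(b)$, $q=\mathbf r(a)\star\mathbf d(b)$, and $a^+=\mathbf d(a)$, $a^*=\mathbf r(a)$. They restrict to isomorphisms between the following categories, with (2,1,1)-homomorphisms and with chain projection ordered functors as morphisms, respectively: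 1. generalized regular $\circ$-semigroups and chain projection ordered groupoids; 2. $P$-restriction semigroups and symmetric chain projection ordered categories; 3. regular $\circ$-semigroups and symmetric chain projection ordered groupoids; 4. restriction semigroups and commutative chain projection ordered categories; 5. inverse semigroups and commutative chain projection ordered groupoids. -/

import Mathlib

open CategoryTheory

universe u

namespace ChainPO

/-! ### Projection algebras -/

/-- Two-sided projection algebras. -/
class ProjectionAlgebra (P : Type u) where
  times : P → P → P
  star : P → P → P
  L1 : ∀ e, times e e = e
  L2 : ∀ e f, times (times e f) e = times e f
  L3 : ∀ e f g, times e (times f g) = times (times e f) (times f g)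
  L4 : ∀ e f g, times (times e f) g = times (times e f) (times e g)
  R1 : ∀ e, star e e = e
  R2 : ∀ e f, star f e = star e (star f e)
  R3 : ∀ e f g, star (star g f) e = star (star g f) (star f e)
  R4 : ∀ e f g, star g (star f e) = star (star g e) (star f e)
  P3_star : ∀ e f g, star (star e (times f g)) g = star (star e f) g
  P3_times : ∀ e f g, times g (times (star g f) e) = times g (times f e)
  P4_times : ∀ e f, star (times e f) e = times e f
  P4_star : ∀ e f, times f (star e f) = star e f

infixl:70 " ×ₚ " => ProjectionAlgebra.times
infixl:70 " ⋆ₚ " => ProjectionAlgebra.star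

/-- Strong projection algebras. -/
class StrongProjectionAlgebra (P : Type u) extends ProjectionAlgebra P where
  SP1 : ∀ e f g : P, e ×ₚ (((e ×ₚ f) ×ₚ g) ⋆ₚ f) = (e ×ₚ f) ×ₚ g
  SP2 : ∀ e f g : P, (f ×ₚ (g ⋆ₚ (f ⋆ₚ e))) ⋆ₚ e = g ⋆ₚ (f ⋆ₚ e)

section ProjectionAlgebra

variable {P : Type u} [ProjectionAlgebra P]

open ProjectionAlgebra

/-- The natural order `e ≤_P f` of a projection algebra. -/
def PLe (e f : P) : Prop := e = f ×ₚ e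

/-- The relation `p 𝓕_P q`. -/
def PF (p q : P) : Prop := p = p ×ₚ q ∧ q = p ⋆ₚ q

/-- `e × f = f ⋆ e` for all `e`, `f`. -/
def IsSymmetricAlg (P : Type u) [ProjectionAlgebra P] : Prop := ∀ e f : P, e ×ₚ f = f ⋆ₚ e

/-- `e × f = f × e` for all `e`, `f`. -/
def IsCommutativeAlg (P : Type u) [ProjectionAlgebra P] : Prop := ∀ e f : P, e ×ₚ f = f ×ₚ e

theorem times_ple (e f : P) : PLe (e ×ₚ f) e := by
  have h := L4 e e f
  rw [L1] at h
  exact h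

theorem star_ple (e f : P) : PLe (e ⋆ₚ f) f := (P4_star e f).symm

theorem PLe.times_eq {e f : P} (h : PLe e f) : e ×ₚ f = e := by
  have h1 : e = f ×ₚ e := h
  have h2 := L2 f e
  rw [← h1] at h2
  exact h2

theorem PLe.star_eq {e f : P} (h : PLe e f) : e ⋆ₚ f = e := by
  have h1 : e = f ×ₚ e := h
  have h2 := P4_times f e
  rw [← h1] at h2
  exact h2

theorem PLe.star_eq' {e f : P} (h : PLe e f) : f ⋆ₚ e = e := by
  have h2 := R2 f e
  rw [h.star_eq] at h2
  exact h2.symm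

theorem times_star_right (e f : P) : (e ×ₚ f) ⋆ₚ f = e ⋆ₚ f := by
  have h := P3_star e e f
  rw [(times_ple e f).star_eq', R1] at h
  exact h

theorem times_star_left (e f : P) : e ×ₚ (e ⋆ₚ f) = e ×ₚ f := by
  have h := P3_times f f e
  rwa [(star_ple e f).times_eq, L1] at h

theorem times_times_self (e f : P) : (e ×ₚ f) ×ₚ f = e ×ₚ f := by
  rw [L4, L1]

theorem star_star_self (e f : P) : e ⋆ₚ (e ⋆ₚ f) = e ⋆ₚ f := by
  rw [R4, R1]

theorem PF_times_star (p q : P) : PF (p ×ₚ q) (p ⋆ₚ q) := by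
  constructor
  · have h := times_star_left (p ×ₚ q) q
    rw [times_star_right, times_times_self] at h
    exact h.symm
  · have h := times_star_right p (p ⋆ₚ q)
    rw [times_star_left, star_star_self] at h
    exact h.symm

theorem PF_refl (p : P) : PF p p := ⟨(L1 p).symm, (R1 p).symm⟩

theorem PF.symm_of_symmetric (hs : IsSymmetricAlg P) {p q : P} (h : PF p q) : PF q p :=
  ⟨h.2.trans (hs q p).symm, h.1.trans (hs p q)⟩

theorem times_of_times_of_ple {p q r : P} (h : p = p ×ₚ q) (h' : PLe q r) : p = p ×ₚ r := by
  have h1 : q = r ×ₚ q := h'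
  have h2 : p = (p ×ₚ r) ×ₚ q := by
    have h3 := L3 p r q
    rw [← h1, ← h] at h3
    exact h3
  rw [L4, ← h, L2] at h2
  exact h2

theorem star_of_star_of_ple {p q r : P} (h : p = q ⋆ₚ p) (h' : PLe q r) : p = r ⋆ₚ p := by
  have h1 : q = q ⋆ₚ r := h'.star_eq.symm
  have h2 : p = q ⋆ₚ (r ⋆ₚ p) := by
    have h3 := R3 p r q
    rw [← h1, ← h] at h3
    exact h3
  rw [R4, ← h, ← R2] at h2
  exact h2

/-! ### Paths -/

/-- `P`-paths `(p₁, …, p_k)`, `k ≥ 1`, with `p₁ 𝓕 p₂ 𝓕 ⋯ 𝓕 p_k`. -/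
@[ext]
structure PPath (P : Type u) [ProjectionAlgebra P] where
  verts : List P
  ne_nil : verts ≠ []
  chain : verts.IsChain PF

namespace PPath

def dom (p : PPath P) : P := p.verts.head p.ne_nil

def cod (p : PPath P) : P := p.verts.getLast p.ne_nil

/-- The path `(p)`. -/
def single (p : P) : PPath P := ⟨[p], by simp, by simp⟩

/-- The path `(p, q)`. -/
def pair (p q : P) (h : PF p q) : PPath P := ⟨[p, q], by simp, by simpa using h⟩

/-- The path `(p, q, s)`. -/
def triple (p q s : P) (h : PF p q) (h' : PF q s) : PPath P :=
  ⟨[p, q, s], by simp, by simpa using ⟨h, h'⟩⟩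

/-- Composition `(p₁, …, p_k = q₁, …, q_l)` in the path category. -/
def comp (p q : PPath P) (h : p.cod = q.dom) : PPath P where
  verts := p.verts ++ q.verts.tail
  ne_nil := by simp [p.ne_nil]
  chain := by
    obtain ⟨l, hl, hc⟩ := p
    obtain ⟨m, hm, hd⟩ := q
    cases m with
    | nil => exact absurd rfl hm
    | cons a m =>
      rw [List.isChain_append]
      refine ⟨hc, hd.tail, ?_⟩
      intro x hx y hy
      have hxl : x = l.getLast hl := by
        rw [List.getLast?_eq_some_getLast hl] at hx
        simpa [eq_comm] using hx
      have ha : x = a := by rw [hxl]; exact h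
      cases m with
      | nil => simp at hy
      | cons b m =>
        have hb : y = b := by simpa [eq_comm] using hy
        subst ha hb
        exact (List.isChain_cons_cons.1 hd).1

/-- The order of the path category: `p = _r⇃q` for some `r ≤_P dom q`, where
`_r⇃(q₁, …, q_k) = (r, r ⋆ q₂, (r ⋆ q₂) ⋆ q₃, …)`. -/
def Le (p q : PPath P) : Prop :=
  ∃ r : P, PLe r q.dom ∧ p.verts = q.verts.tail.scanl (· ⋆ₚ ·) r

/-- The image of a path under a map that preserves `𝓕`. -/
def map {Q : Type u} [ProjectionAlgebra Q] (φ : P → Q) (hφ : ∀ p q, PF p q → PF (φ p) (φ q))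
    (p : PPath P) : PPath Q where
  verts := p.verts.map φ
  ne_nil := by simp [p.ne_nil]
  chain := by
    rw [List.isChain_map]
    exact p.chain.imp hφ

end PPath

end ProjectionAlgebra

/-! ### Ordered categories -/

/-- Small categories presented by their set `C` of arrows: `d a`, `r a` are the identity arrows at
the source and the target of `a`, and `a ∘ b` is defined exactly if `r a = d b`. -/
class ArrowCat (C : Type u) where
  d : C → C
  r : C → C
  comp : (a b : C) → r a = d b → C
  d_comp : ∀ a b h, d (comp a b h) = d a
  r_comp : ∀ a b h, r (comp a b h) = r b
  assoc : ∀ a b c (h : r a = d b) (h' : r b = d c),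
    comp (comp a b h) c ((r_comp a b h).trans h') = comp a (comp b c h') (h.trans (d_comp b c h').symm)
  r_d : ∀ a, r (d a) = d a
  d_r : ∀ a, r a = d (r a)
  d_comp_self : ∀ a, comp (d a) a (r_d a) = a
  comp_r_self : ∀ a, comp a (r a) (d_r a) = a

open ArrowCat

/-- The set `P_C` of objects (identity arrows). -/
abbrev Obj (C : Type u) [ArrowCat C] : Type u := Set.range (d : C → C)

section

variable {C : Type u} [ArrowCat C]

def dObj (a : C) : Obj C := ⟨d a, a, rfl⟩

def rObj (a : C) : Obj C := ⟨r a, r a, (d_r a).symm⟩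

theorem d_obj (p : Obj C) : d p.1 = p.1 := by
  obtain ⟨_, a, rfl⟩ := p
  change d (d a) = d a
  have h := d_r (d a)
  rw [r_d] at h
  exact h.symm

end

/-- Every arrow is invertible. -/
def IsArrowGroupoid (C : Type u) [ArrowCat C] : Prop :=
  ∀ a : C, ∃ (b : C) (h : r a = d b) (h' : r b = d a), comp a b h = d a ∧ comp b a h' = r a

class OrderedCat (C : Type u) extends ArrowCat C, PartialOrder C where
  O1_d : ∀ a b : C, a ≤ b → d a ≤ d b
  O1_r : ∀ a b : C, a ≤ b → r a ≤ r b
  O2 : ∀ (a b c e : C) (h : r a = d c) (h' : r b = d e), a ≤ b → c ≤ e → comp a c h ≤ comp b e h'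
  O3 : ∀ (a : C) (p : Obj C), p.1 ≤ d a → ∃! x : C, x ≤ a ∧ d x = p.1
  O4 : ∀ (a : C) (q : Obj C), q.1 ≤ r a → ∃! x : C, x ≤ a ∧ r x = q.1

section

variable {C : Type u} [OrderedCat C]

/-- The left restriction `_p⇃a`, for `p ≤ d a`. -/
noncomputable def lres (p : Obj C) (a : C) (h : p.1 ≤ d a) : C := (OrderedCat.O3 a p h).choose

/-- The right restriction `a⇂_q`, for `q ≤ r a`. -/
noncomputable def rres (a : C) (q : Obj C) (h : q.1 ≤ r a) : C := (OrderedCat.O4 a q h).choose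

theorem lres_le (p : Obj C) (a : C) (h) : lres p a h ≤ a := (OrderedCat.O3 a p h).choose_spec.1.1

theorem d_lres (p : Obj C) (a : C) (h) : d (lres p a h) = p.1 :=
  (OrderedCat.O3 a p h).choose_spec.1.2

theorem rres_le (a : C) (q : Obj C) (h) : rres a q h ≤ a := (OrderedCat.O4 a q h).choose_spec.1.1

theorem r_rres (a : C) (q : Obj C) (h) : r (rres a q h) = q.1 :=
  (OrderedCat.O4 a q h).choose_spec.1.2

end

/-! ### Projection ordered categories -/

class WeakProjectionOrderedCat (C : Type u) extends OrderedCat C where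
  alg : StrongProjectionAlgebra (Obj C)
  le_iff : ∀ p q : Obj C, p.1 ≤ q.1 ↔ PLe p q

instance {C : Type u} [WeakProjectionOrderedCat C] : StrongProjectionAlgebra (Obj C) :=
  WeakProjectionOrderedCat.alg

section

variable {C : Type u} [WeakProjectionOrderedCat C]

theorem le_of_ple {p q : Obj C} (h : PLe p q) : p.1 ≤ q.1 :=
  (WeakProjectionOrderedCat.le_iff p q).2 h

/-- The map `Θ_a : x ↦ r (_{x ⋆ d a}⇃a)`. -/
noncomputable def Theta (a : C) (x : Obj C) : Obj C :=
  rObj (lres (x ⋆ₚ dObj a) a (le_of_ple (star_ple x (dObj a))))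

/-- The map `Δ_a : y ↦ d (a⇂_{r a × y})`. -/
noncomputable def Delta (a : C) (y : Obj C) : Obj C :=
  dObj (rres a (rObj a ×ₚ y) (le_of_ple (times_ple (rObj a) y)))

theorem Theta_le (a : C) (x : Obj C) : (Theta a x).1 ≤ r a :=
  OrderedCat.O1_r _ _ (lres_le _ _ _)

theorem Delta_le (a : C) (y : Obj C) : (Delta a y).1 ≤ d a :=
  OrderedCat.O1_d _ _ (rres_le _ _ _)

theorem Theta_ple (a : C) (x : Obj C) : PLe (Theta a x) (rObj a) :=
  (WeakProjectionOrderedCat.le_iff _ _).1 (Theta_le a x)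

theorem Delta_ple (a : C) (y : Obj C) : PLe (Delta a y) (dObj a) :=
  (WeakProjectionOrderedCat.le_iff _ _).1 (Delta_le a y)

end

/-- Projection ordered categories. Maps being written on the right, the two conditions read
`δ_{p Θ_a} = Δ_a δ_p Θ_a` and `θ_{p Δ_a} = Θ_a θ_p Δ_a`, where `t δ_p = p × t` and
`t θ_p = t ⋆ p`. -/
class ProjectionOrderedCat (C : Type u) extends WeakProjectionOrderedCat C where
  G1_delta : ∀ (a : C) (p t : Obj C), Theta a p ×ₚ t = Theta a (p ×ₚ Delta a t)
  G1_theta : ∀ (a : C) (p t : Obj C), t ⋆ₚ Delta a p = Delta a (Theta a t ⋆ₚ p)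

/-! ### Chain projection ordered categories -/

/-- Evaluation maps. -/
@[ext]
structure EvaluationMap (C : Type u) [ProjectionOrderedCat C] where
  toFun : PPath (Obj C) → C
  E1_single : ∀ p : Obj C, toFun (.single p) = p.1
  E1_pair : ∀ p : Obj C, toFun (.pair p p (PF_refl p)) = p.1
  E2_d : ∀ p, d (toFun p) = p.dom.1
  E2_r : ∀ p, r (toFun p) = p.cod.1
  E3 : ∀ (p q : PPath (Obj C)) (h : p.cod = q.dom), toFun (p.comp q h) =
    comp (toFun p) (toFun q) ((E2_r p).trans ((congrArg Subtype.val h).trans (E2_d q).symm))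
  E4 : ∀ p q : PPath (Obj C), p.Le q → toFun p ≤ toFun q

section

variable {C : Type u} [ProjectionOrderedCat C]

namespace EvaluationMap

/-- `ε(p, q)` for `p 𝓕 q`. -/
def two (ε : EvaluationMap C) (p q : Obj C) (h : PF p q) : C := ε.toFun (.pair p q h)

theorem d_two (ε : EvaluationMap C) (p q : Obj C) (h : PF p q) : d (ε.two p q h) = p.1 := ε.E2_d _

theorem r_two (ε : EvaluationMap C) (p q : Obj C) (h : PF p q) : r (ε.two p q h) = q.1 := ε.E2_r _

/-- `ε(e, e') ∘ x ∘ ε(f', f)` for an arrow `x` from `e'` to `f'`. -/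
def sandwich (ε : EvaluationMap C) (e e' : Obj C) (he : PF e e') (x : C) (f' f : Obj C)
    (hf : PF f' f) (hd : d x = e'.1) (hr : r x = f'.1) : C :=
  comp (comp (ε.two e e' he) x ((ε.r_two e e' he).trans hd.symm)) (ε.two f' f hf)
    ((r_comp _ _ _).trans (hr.trans (ε.d_two f' f hf).symm))

end EvaluationMap

/-- `(e, f)` is a `b`-linked pair: `f = e Θ_b θ_f` and `e = f Δ_b δ_e`. -/
structure IsLinkedPair (b : C) (e f : Obj C) : Prop where
  right : f = Theta b e ⋆ₚ f
  left : e = e ×ₚ Delta b f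

namespace IsLinkedPair

variable {b : C} {e f : Obj C}

theorem PF_e₂ (h : IsLinkedPair b e f) : PF e (Delta b f) :=
  ⟨h.left, by rw [ProjectionOrderedCat.G1_theta, ← h.right]⟩

theorem PF_f₁ (h : IsLinkedPair b e f) : PF (Theta b e) f :=
  ⟨by rw [ProjectionOrderedCat.G1_delta, ← h.left], h.right⟩

theorem PF_e₁ (h : IsLinkedPair b e f) : PF e (e ⋆ₚ dObj b) := by
  have h1 : e = e ×ₚ dObj b := times_of_times_of_ple h.left (Delta_ple b f)
  exact ⟨by rw [times_star_left, ← h1], (star_star_self _ _).symm⟩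

theorem PF_f₂ (h : IsLinkedPair b e f) : PF (rObj b ×ₚ f) f := by
  have h1 : f = rObj b ⋆ₚ f := star_of_star_of_ple h.right (Theta_ple b e)
  exact ⟨(times_times_self _ _).symm, by rw [times_star_right, ← h1]⟩

end IsLinkedPair

/-- `λ(e, b, f) = ε(e, e₁) ∘ _{e₁}⇃b ∘ ε(f₁, f)` with `e₁ = e ⋆ d b` and `f₁ = e Θ_b`. -/
noncomputable def lam (ε : EvaluationMap C) (b : C) (e f : Obj C) (h : IsLinkedPair b e f) : C :=
  ε.sandwich e (e ⋆ₚ dObj b) h.PF_e₁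
    (lres (e ⋆ₚ dObj b) b (le_of_ple (star_ple e (dObj b))))
    (Theta b e) f h.PF_f₁ (d_lres _ _ _) rfl

/-- `ρ(e, b, f) = ε(e, e₂) ∘ b⇂_{f₂} ∘ ε(f₂, f)` with `e₂ = f Δ_b` and `f₂ = r b × f`. -/
noncomputable def rho (ε : EvaluationMap C) (b : C) (e f : Obj C) (h : IsLinkedPair b e f) : C :=
  ε.sandwich e (Delta b f) h.PF_e₂
    (rres b (rObj b ×ₚ f) (le_of_ple (times_ple (rObj b) f)))
    (rObj b ×ₚ f) f h.PF_f₂ rfl (r_rres _ _ _)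

end

class ChainProjectionOrderedCat (C : Type u) extends ProjectionOrderedCat C where
  ε : EvaluationMap C
  G2 : ∀ (b : C) (e f : Obj C) (h : IsLinkedPair b e f), lam ε b e f h = rho ε b e f h

section

variable {C : Type u} [ChainProjectionOrderedCat C]

/-- The product
`a • b = a⇂_{r a × d b} ∘ ε(r a × d b, r a ⋆ d b) ∘ _{r a ⋆ d b}⇃b`. -/
noncomputable def bullet (a b : C) : C :=
  comp
    (comp (rres a (rObj a ×ₚ dObj b) (le_of_ple (times_ple (rObj a) (dObj b))))
      (ChainProjectionOrderedCat.ε.two (rObj a ×ₚ dObj b) (rObj a ⋆ₚ dObj b) (PF_times_star _ _))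
      ((r_rres _ _ _).trans (EvaluationMap.d_two _ _ _ _).symm))
    (lres (rObj a ⋆ₚ dObj b) b (le_of_ple (star_ple (rObj a) (dObj b))))
    ((r_comp _ _ _).trans ((EvaluationMap.r_two _ _ _ _).trans (d_lres _ _ _).symm))

end

/-- `P_C` is symmetric, and `ε(p, q, p) = p` whenever `p 𝓕 q`. -/
def IsSymmetricChain (C : Type u) [ChainProjectionOrderedCat C] : Prop :=
  ∃ hs : IsSymmetricAlg (Obj C), ∀ (p q : Obj C) (h : PF p q),
    ChainProjectionOrderedCat.ε.toFun (.triple p q p h (h.symm_of_symmetric hs)) = p.1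

/-- `P_C` is commutative. -/
def IsCommutativeChain (C : Type u) [ChainProjectionOrderedCat C] : Prop :=
  IsCommutativeAlg (Obj C)

/-! ### The category of chain projection ordered categories -/

/-- The map that a map commuting with `d` induces on objects. -/
def objMap {C D : Type u} [ArrowCat C] [ArrowCat D] (φ : C → D) (h : ∀ a, d (φ a) = φ (d a))
    (p : Obj C) : Obj D :=
  ⟨φ p.1, φ p.1, by rw [h, d_obj]⟩

/-- Chain projection ordered functors. -/
@[ext]
structure ChainFunctor (C D : Type u) [ChainProjectionOrderedCat C]
    [ChainProjectionOrderedCat D] where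
  toFun : C → D
  F1_d : ∀ a, d (toFun a) = toFun (d a)
  F1_r : ∀ a, r (toFun a) = toFun (r a)
  F2 : ∀ (a b : C) (h : r a = d b), toFun (comp a b h) =
    comp (toFun a) (toFun b) ((F1_r a).trans ((congrArg toFun h).trans (F1_d b).symm))
  F3 : ∀ a b : C, a ≤ b → toFun a ≤ toFun b
  F4_times : ∀ e f : Obj C,
    objMap toFun F1_d (e ×ₚ f) = objMap toFun F1_d e ×ₚ objMap toFun F1_d f
  F4_star : ∀ e f : Obj C,
    objMap toFun F1_d (e ⋆ₚ f) = objMap toFun F1_d e ⋆ₚ objMap toFun F1_d f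
  F5 : ∀ p : PPath (Obj C), toFun (ChainProjectionOrderedCat.ε.toFun p) =
    ChainProjectionOrderedCat.ε.toFun (p.map (objMap toFun F1_d) fun p q h =>
      ⟨(congrArg (objMap toFun F1_d) h.1).trans (F4_times p q),
        (congrArg (objMap toFun F1_d) h.2).trans (F4_star p q)⟩)

def ChainFunctor.id (C : Type u) [ChainProjectionOrderedCat C] : ChainFunctor C C where
  toFun a := a
  F1_d _ := rfl
  F1_r _ := rfl
  F2 _ _ _ := rfl
  F3 _ _ h := h
  F4_times _ _ := rfl
  F4_star _ _ := rfl
  F5 _ := congrArg ChainProjectionOrderedCat.ε.toFun (PPath.ext (List.map_id _).symm)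

def ChainFunctor.comp {C D E : Type u} [ChainProjectionOrderedCat C]
    [ChainProjectionOrderedCat D] [ChainProjectionOrderedCat E]
    (φ : ChainFunctor C D) (ψ : ChainFunctor D E) : ChainFunctor C E where
  toFun a := ψ.toFun (φ.toFun a)
  F1_d a := by rw [ψ.F1_d, φ.F1_d]
  F1_r a := by rw [ψ.F1_r, φ.F1_r]
  F2 a b h := by simp only [φ.F2, ψ.F2]
  F3 a b h := ψ.F3 _ _ (φ.F3 _ _ h)
  F4_times e f := (congrArg (objMap ψ.toFun ψ.F1_d) (φ.F4_times e f)).trans (ψ.F4_times _ _)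
  F4_star e f := (congrArg (objMap ψ.toFun ψ.F1_d) (φ.F4_star e f)).trans (ψ.F4_star _ _)
  F5 p := by
    simp only [φ.F5, ψ.F5]
    congr 1
    exact PPath.ext (List.map_map)

/-- Chain projection ordered categories; arrow sets are nonempty. -/
structure CPOC : Type (u + 1) where
  carrier : Type u
  nonempty : Nonempty carrier
  str : ChainProjectionOrderedCat carrier

instance (C : CPOC.{u}) : ChainProjectionOrderedCat C.carrier := C.str

instance : Category CPOC.{u} where
  Hom C D := ChainFunctor C.carrier D.carrier
  id C := ChainFunctor.id C.carrier
  comp φ ψ := φ.comp ψ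

/-- The underlying set functor. -/
def CPOC.underlying : CPOC.{u} ⥤ Type u where
  obj C := C.carrier
  map φ := TypeCat.ofHom φ.toFun

/-- Chain projection ordered groupoids. -/
def CPOC.isGroupoid : ObjectProperty CPOC.{u} := fun C => IsArrowGroupoid C.carrier

/-- Symmetric chain projection ordered categories. -/
def CPOC.isSymmetric : ObjectProperty CPOC.{u} := fun C => IsSymmetricChain C.carrier

/-- Commutative chain projection ordered categories. -/
def CPOC.isCommutative : ObjectProperty CPOC.{u} := fun C => IsCommutativeChain C.carrier

/-- Symmetric chain projection ordered groupoids. -/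
def CPOC.isSymmetricGroupoid : ObjectProperty CPOC.{u} :=
  fun C => IsSymmetricChain C.carrier ∧ IsArrowGroupoid C.carrier

/-- Commutative chain projection ordered groupoids. -/
def CPOC.isCommutativeGroupoid : ObjectProperty CPOC.{u} :=
  fun C => IsCommutativeChain C.carrier ∧ IsArrowGroupoid C.carrier

/-! ### Classes of semigroups -/

/-- Semigroups with two unary operations `x ↦ x⁺` and `x ↦ x*`. -/
class BiunarySemigroup (S : Type u) extends Semigroup S where
  plus : S → S
  ast : S → S

postfix:max "⁺ˢ" => BiunarySemigroup.plus
postfix:max "∗ˢ" => BiunarySemigroup.ast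

/-- DRC-restriction semigroups. -/
class DRCRestrictionSemigroup (S : Type u) extends BiunarySemigroup S where
  plus_mul_self : ∀ x : S, x⁺ˢ * x = x
  mul_ast_self : ∀ x : S, x * x∗ˢ = x
  plus_mul : ∀ x y : S, (x * y)⁺ˢ = (x * y⁺ˢ)⁺ˢ
  ast_mul : ∀ x y : S, (x * y)∗ˢ = (x∗ˢ * y)∗ˢ
  plus_mul_eq : ∀ x y : S, (x * y)⁺ˢ = x⁺ˢ * (x * y)⁺ˢ * x⁺ˢ
  ast_mul_eq : ∀ x y : S, (x * y)∗ˢ = y∗ˢ * (x * y)∗ˢ * y∗ˢ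
  plus_plus : ∀ x : S, x⁺ˢ⁺ˢ = x⁺ˢ
  ast_ast : ∀ x : S, x∗ˢ∗ˢ = x∗ˢ
  plus_ast : ∀ x : S, x⁺ˢ∗ˢ = x⁺ˢ
  ast_plus : ∀ x : S, x∗ˢ⁺ˢ = x∗ˢ
  ample_ast : ∀ x y : S, x * (y * x)∗ˢ = (y * x⁺ˢ)∗ˢ * x
  ample_plus : ∀ x y : S, (x * y)⁺ˢ * x = x * (x∗ˢ * y)⁺ˢ

/-- `P`-restriction semigroups. -/
class PRestrictionSemigroup (S : Type u) extends BiunarySemigroup S where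
  plus_mul_self : ∀ x : S, x⁺ˢ * x = x
  plus_mul : ∀ x y : S, (x * y)⁺ˢ = (x * y⁺ˢ)⁺ˢ
  plus_proj : ∀ x y : S, (x⁺ˢ * y⁺ˢ)⁺ˢ = x⁺ˢ * y⁺ˢ * x⁺ˢ
  plus_idem : ∀ x : S, x⁺ˢ * x⁺ˢ = x⁺ˢ
  plus_ast : ∀ x : S, x⁺ˢ∗ˢ = x⁺ˢ
  mul_ast_self : ∀ x : S, x * x∗ˢ = x
  ast_mul : ∀ x y : S, (x * y)∗ˢ = (x∗ˢ * y)∗ˢ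
  ast_proj : ∀ x y : S, (x∗ˢ * y∗ˢ)∗ˢ = y∗ˢ * x∗ˢ * y∗ˢ
  ast_idem : ∀ x : S, x∗ˢ * x∗ˢ = x∗ˢ
  ast_plus : ∀ x : S, x∗ˢ⁺ˢ = x∗ˢ
  ample_plus : ∀ x y : S, (x * y)⁺ˢ * x = x * y⁺ˢ * x∗ˢ
  ample_ast : ∀ x y : S, x * (y * x)∗ˢ = x⁺ˢ * y∗ˢ * x

/-- Restriction semigroups, as algebras `(S, ·, ⁺, *)`. -/
class RestrictionSemigroup (S : Type u) extends BiunarySemigroup S where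
  plus_mul_self : ∀ x : S, x⁺ˢ * x = x
  plus_comm : ∀ x y : S, x⁺ˢ * y⁺ˢ = y⁺ˢ * x⁺ˢ
  plus_proj : ∀ x y : S, y⁺ˢ * x⁺ˢ = (x⁺ˢ * y⁺ˢ)⁺ˢ
  plus_mul_le : ∀ x y : S, x⁺ˢ * (x * y)⁺ˢ = (x * y)⁺ˢ
  plus_mul : ∀ x y : S, (x * y)⁺ˢ = (x * y⁺ˢ)⁺ˢ
  plus_ast : ∀ x : S, x⁺ˢ∗ˢ = x⁺ˢ
  mul_ast_self : ∀ x : S, x * x∗ˢ = x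
  ast_comm : ∀ x y : S, x∗ˢ * y∗ˢ = y∗ˢ * x∗ˢ
  ast_proj : ∀ x y : S, y∗ˢ * x∗ˢ = (x∗ˢ * y∗ˢ)∗ˢ
  ast_mul_le : ∀ x y : S, (x * y)∗ˢ * y∗ˢ = (x * y)∗ˢ
  ast_mul : ∀ x y : S, (x * y)∗ˢ = (x∗ˢ * y)∗ˢ
  ast_plus : ∀ x : S, x∗ˢ⁺ˢ = x∗ˢ
  ample_plus : ∀ x y : S, (x * y)⁺ˢ * x = x * y⁺ˢ
  ample_ast : ∀ x y : S, x * (y * x)∗ˢ = y∗ˢ * x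

/-- Semigroups with a unary operation `x ↦ x°`. -/
class UnarySemigroup (S : Type u) extends Semigroup S where
  circ : S → S

postfix:max "°ˢ" => UnarySemigroup.circ

/-- Generalized regular ∘-semigroups. -/
class GenRegularCircSemigroup (S : Type u) extends UnarySemigroup S where
  mul_circ_mul : ∀ x : S, x * x°ˢ * x = x
  circ_circ : ∀ x : S, x°ˢ°ˢ = x
  circ_mul_right : ∀ x y : S, (x * y)°ˢ = (x * y)°ˢ * x * x°ˢ
  circ_mul_left : ∀ x y : S, (x * y)°ˢ = y°ˢ * y * (x * y)°ˢ
  circ_mul_self : ∀ x y : S, (x * y)°ˢ * x = (x°ˢ * x * y)°ˢ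

/-- Regular ∘-semigroups. -/
class RegularCircSemigroup (S : Type u) extends UnarySemigroup S where
  mul_circ_mul : ∀ x : S, x * x°ˢ * x = x
  circ_circ : ∀ x : S, x°ˢ°ˢ = x
  circ_mul : ∀ x y : S, (x * y)°ˢ = y°ˢ * x°ˢ

/-- Inverse semigroups: regular semigroups whose idempotents commute. -/
class InverseSemigroup (S : Type u) extends Semigroup S where
  regular : ∀ x : S, ∃ a : S, x * a * x = x ∧ a * x * a = a
  idem_comm : ∀ e f : S, e * e = e → f * f = f → e * f = f * e

/-! ### Each of the classes yields DRC-restriction semigroups -/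

/-- A `P`-restriction semigroup is DRC-restriction. -/
@[reducible]
def PRestrictionSemigroup.toDRC {S : Type u} (h : PRestrictionSemigroup S) :
    DRCRestrictionSemigroup S where
  toBiunarySemigroup := h.toBiunarySemigroup
  plus_mul_self := h.plus_mul_self
  mul_ast_self := h.mul_ast_self
  plus_mul := h.plus_mul
  ast_mul := h.ast_mul
  plus_mul_eq x y := by
    have h1 := h.plus_mul x⁺ˢ (x * y)
    rwa [← mul_assoc, h.plus_mul_self, h.plus_proj] at h1
  ast_mul_eq x y := by
    have h1 := h.ast_mul (x * y) y∗ˢ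
    rwa [mul_assoc, h.mul_ast_self, h.ast_proj] at h1
  plus_plus x := by
    have := h.plus_proj x x
    simpa only [h.plus_idem] using this
  ast_ast x := by
    have := h.ast_proj x x
    simpa only [h.ast_idem] using this
  plus_ast := h.plus_ast
  ast_plus := h.ast_plus
  ample_ast x y := by
    have h1 := h.ast_proj y x⁺ˢ
    rw [h.plus_ast, ← h.ast_mul] at h1
    rw [h1, h.ample_ast, mul_assoc, mul_assoc, mul_assoc, h.plus_mul_self]
  ample_plus x y := by
    have h1 := h.plus_proj x∗ˢ y
    rw [h.ast_plus, ← h.plus_mul] at h1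
    rw [h1, h.ample_plus, ← mul_assoc, ← mul_assoc, h.mul_ast_self]

/-- A restriction semigroup is DRC-restriction. -/
@[reducible]
def RestrictionSemigroup.toDRC {S : Type u} (h : RestrictionSemigroup S) :
    DRCRestrictionSemigroup S :=
  have pp : ∀ x : S, x⁺ˢ⁺ˢ = x⁺ˢ := fun x => by
    have h1 := h.ast_plus x⁺ˢ
    rwa [h.plus_ast] at h1
  have aa : ∀ x : S, x∗ˢ∗ˢ = x∗ˢ := fun x => by
    have h1 := h.plus_ast x∗ˢ
    rwa [h.ast_plus] at h1
  { toBiunarySemigroup := h.toBiunarySemigroup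
    plus_mul_self := h.plus_mul_self
    mul_ast_self := h.mul_ast_self
    plus_mul := h.plus_mul
    ast_mul := h.ast_mul
    plus_mul_eq := fun x y => by
      rw [h.plus_mul_le, h.plus_comm, h.plus_mul_le]
    ast_mul_eq := fun x y => by
      rw [mul_assoc, h.ast_mul_le, h.ast_comm, h.ast_mul_le]
    plus_plus := pp
    ast_ast := aa
    plus_ast := h.plus_ast
    ast_plus := h.ast_plus
    ample_ast := fun x y => by
      have h1 := h.ast_proj y x⁺ˢ
      rw [h.plus_ast, ← h.ast_mul] at h1
      have h2 := h.ast_comm y x⁺ˢ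
      rw [h.plus_ast] at h2
      rw [← h1, ← h2, mul_assoc, h.plus_mul_self, h.ample_ast]
    ample_plus := fun x y => by
      have h1 := h.plus_proj x∗ˢ y
      rw [h.ast_plus, ← h.plus_mul] at h1
      have h2 := h.plus_comm x∗ˢ y
      rw [h.ast_plus] at h2
      rw [← h1, ← h2, ← mul_assoc, h.mul_ast_self, h.ample_plus] }

section GenRegular

variable {S : Type u}

theorem GenRegularCircSemigroup.circ_mul_circ [h : GenRegularCircSemigroup S] (x : S) :
    x°ˢ * x * x°ˢ = x°ˢ := by
  have h1 := h.mul_circ_mul x°ˢ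
  rwa [h.circ_circ] at h1

theorem GenRegularCircSemigroup.mul_circ_self [h : GenRegularCircSemigroup S] (x y : S) :
    y * (x * y)°ˢ = (x * y * y°ˢ)°ˢ := by
  have h1 := h.circ_mul_self y (x * y)°ˢ
  rw [← h.circ_mul_left, h.circ_circ] at h1
  have h2 := h.circ_mul_right y (x * y)°ˢ
  rw [h1] at h2
  rw [← h2, h.circ_circ]

theorem GenRegularCircSemigroup.circ_plus [h : GenRegularCircSemigroup S] (x : S) :
    (x * x°ˢ)°ˢ = x * x°ˢ := by
  have h1 := h.circ_mul_self x x°ˢ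
  rw [circ_mul_circ, h.circ_circ] at h1
  have h2 := h.circ_mul_right x x°ˢ
  rwa [h1] at h2

theorem GenRegularCircSemigroup.circ_ast [h : GenRegularCircSemigroup S] (x : S) :
    (x°ˢ * x)°ˢ = x°ˢ * x := by
  have h1 := circ_plus x°ˢ
  rwa [h.circ_circ] at h1

/-- A generalized regular ∘-semigroup is DRC-restriction with `x⁺ = x x°`, `x* = x° x`. -/
@[reducible]
def GenRegularCircSemigroup.toDRC (h : GenRegularCircSemigroup S) :
    DRCRestrictionSemigroup S where
  toSemigroup := h.toSemigroup
  plus x := x * x°ˢ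
  ast x := x°ˢ * x
  plus_mul_self x := h.mul_circ_mul x
  mul_ast_self x := by rw [← mul_assoc, h.mul_circ_mul]
  plus_mul x y := by
    have h1 := mul_circ_self x y
    rw [← mul_assoc x y, ← h1]
    simp only [mul_assoc]
    rw [← mul_assoc y°ˢ, ← h.circ_mul_left]
  ast_mul x y := by
    rw [← h.circ_mul_self x y]
    simp only [← mul_assoc]
    rw [← h.circ_mul_right]
  plus_mul_eq x y := by
    have h1 := h.circ_mul_right x y
    have h2 : x * x°ˢ * (x * y) = x * y := by rw [← mul_assoc, h.mul_circ_mul]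
    rw [← mul_assoc (x * x°ˢ), h2, mul_assoc (x * y), ← mul_assoc (x * y)°ˢ, ← h1]
  ast_mul_eq x y := by
    have h1 := h.circ_mul_left x y
    have h2 : x * y * (y°ˢ * y) = x * y := by
      rw [mul_assoc, ← mul_assoc y, h.mul_circ_mul]
    rw [← mul_assoc (y°ˢ * y), ← h1, mul_assoc, h2]
  plus_plus x := by rw [circ_plus, ← mul_assoc, h.mul_circ_mul]
  ast_ast x := by rw [circ_ast, ← mul_assoc, circ_mul_circ]
  plus_ast x := by rw [circ_plus, ← mul_assoc, h.mul_circ_mul]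
  ast_plus x := by rw [circ_ast, ← mul_assoc, circ_mul_circ]
  ample_ast x y := by
    have h1 := mul_circ_self y x
    rw [← mul_assoc y x, ← h1, ← mul_assoc x (y * x)°ˢ]
    simp only [mul_assoc]
    rw [← mul_assoc x x°ˢ x, h.mul_circ_mul]
  ample_plus x y := by
    rw [← h.circ_mul_self x y]
    simp only [← mul_assoc]
    rw [h.mul_circ_mul]

end GenRegular

/-- A regular ∘-semigroup is a generalized regular ∘-semigroup. -/
@[reducible]
def RegularCircSemigroup.toGenRegular {S : Type u} (h : RegularCircSemigroup S) :
    GenRegularCircSemigroup S :=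
  have hc : ∀ x : S, x°ˢ * x * x°ˢ = x°ˢ := fun x => by
    have h1 := h.mul_circ_mul x°ˢ
    rwa [h.circ_circ] at h1
  { toUnarySemigroup := h.toUnarySemigroup
    mul_circ_mul := h.mul_circ_mul
    circ_circ := h.circ_circ
    circ_mul_right := fun x y => by
      rw [h.circ_mul, mul_assoc, mul_assoc, ← mul_assoc x°ˢ, hc]
    circ_mul_left := fun x y => by
      rw [h.circ_mul, ← mul_assoc, hc]
    circ_mul_self := fun x y => by
      rw [h.circ_mul, h.circ_mul, h.circ_mul, h.circ_circ, mul_assoc] }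

section Inverse

variable {S : Type u} [InverseSemigroup S]

/-- The inverse `x⁻¹` of an element of an inverse semigroup. -/
noncomputable def invElt (x : S) : S := (InverseSemigroup.regular x).choose

theorem mul_invElt_mul (x : S) : x * invElt x * x = x :=
  (InverseSemigroup.regular x).choose_spec.1

theorem invElt_mul_invElt (x : S) : invElt x * x * invElt x = invElt x :=
  (InverseSemigroup.regular x).choose_spec.2

theorem inverse_unique {x a b : S} (ha : x * a * x = x) (ha' : a * x * a = a)
    (hb : x * b * x = x) (hb' : b * x * b = b) : a = b := by
  have e1 : (x * a) * (x * a) = x * a := by rw [← mul_assoc, ha]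
  have e2 : (x * b) * (x * b) = x * b := by rw [← mul_assoc, hb]
  have e3 : (a * x) * (a * x) = a * x := by rw [← mul_assoc, ha']
  have e4 : (b * x) * (b * x) = b * x := by rw [← mul_assoc, hb']
  have c1 := InverseSemigroup.idem_comm _ _ e1 e2
  have c2 := InverseSemigroup.idem_comm _ _ e3 e4
  have h1 : x * a = x * b := by
    have h2 : x * b * (x * a) = x * a := by rw [← mul_assoc, hb]
    have h3 : x * a * (x * b) = x * b := by rw [← mul_assoc, ha]
    rw [← h2, ← c1, h3]
  have h4 : a * x = b * x := by
    have h2 : a * x * (b * x) = a * x := by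
      rw [mul_assoc, ← mul_assoc x, hb]
    have h3 : b * x * (a * x) = b * x := by
      rw [mul_assoc, ← mul_assoc x, ha]
    rw [← h2, c2, h3]
  rw [← ha', h4, mul_assoc, h1, ← mul_assoc, hb']

theorem eq_invElt {x a : S} (ha : x * a * x = x) (ha' : a * x * a = a) : a = invElt x :=
  inverse_unique ha ha' (mul_invElt_mul x) (invElt_mul_invElt x)

end Inverse

/-- An inverse semigroup is a regular ∘-semigroup with `x° = x⁻¹`. -/
@[reducible]
noncomputable def InverseSemigroup.toRegularCirc {S : Type u} (h : InverseSemigroup S) :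
    RegularCircSemigroup S where
  toSemigroup := h.toSemigroup
  circ := invElt
  mul_circ_mul := mul_invElt_mul
  circ_circ x := (eq_invElt (invElt_mul_invElt x) (mul_invElt_mul x)).symm
  circ_mul x y := by
    have e1 : (y * invElt y) * (y * invElt y) = y * invElt y := by
      rw [← mul_assoc, mul_invElt_mul]
    have e2 : (invElt x * x) * (invElt x * x) = invElt x * x := by
      rw [← mul_assoc, invElt_mul_invElt]
    have c := h.idem_comm _ _ e1 e2
    symm
    apply eq_invElt
    · calc x * y * (invElt y * invElt x) * (x * y)
          = x * ((y * invElt y) * (invElt x * x)) * y := by simp only [mul_assoc]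
        _ = (x * invElt x * x) * (y * invElt y * y) := by rw [c]; simp only [mul_assoc]
        _ = x * y := by rw [mul_invElt_mul, mul_invElt_mul]
    · calc invElt y * invElt x * (x * y) * (invElt y * invElt x)
          = invElt y * ((invElt x * x) * (y * invElt y)) * invElt x := by simp only [mul_assoc]
        _ = (invElt y * y * invElt y) * (invElt x * x * invElt x) := by
            rw [← c]; simp only [mul_assoc]
        _ = invElt y * invElt x := by rw [invElt_mul_invElt, invElt_mul_invElt]

/-! ### The categories of semigroups -/

/-- (2,1,1)-homomorphisms. -/
@[ext]
structure BiunaryHom (S T : Type u) [BiunarySemigroup S] [BiunarySemigroup T] where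
  toFun : S → T
  map_mul : ∀ x y, toFun (x * y) = toFun x * toFun y
  map_plus : ∀ x, toFun x⁺ˢ = (toFun x)⁺ˢ
  map_ast : ∀ x, toFun x∗ˢ = (toFun x)∗ˢ

/-- DRC-restriction semigroups; semigroups are nonempty. -/
structure DRS : Type (u + 1) where
  carrier : Type u
  nonempty : Nonempty carrier
  str : DRCRestrictionSemigroup carrier

instance (S : DRS.{u}) : DRCRestrictionSemigroup S.carrier := S.str

/-- The category of DRC-restriction semigroups and (2,1,1)-homomorphisms. -/
instance : Category DRS.{u} where
  Hom S T := BiunaryHom S.carrier T.carrier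
  id S := ⟨fun x => x, fun _ _ => rfl, fun _ => rfl, fun _ => rfl⟩
  comp φ ψ :=
    { toFun := fun x => ψ.toFun (φ.toFun x)
      map_mul := fun x y => by rw [φ.map_mul, ψ.map_mul]
      map_plus := fun x => by rw [φ.map_plus, ψ.map_plus]
      map_ast := fun x => by rw [φ.map_ast, ψ.map_ast] }

/-- The underlying set functor. -/
def DRS.underlying : DRS.{u} ⥤ Type u where
  obj S := S.carrier
  map φ := TypeCat.ofHom φ.toFun

structure GenRegularCirc : Type (u + 1) where
  carrier : Type u
  nonempty : Nonempty carrier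
  str : GenRegularCircSemigroup carrier

structure PRestriction : Type (u + 1) where
  carrier : Type u
  nonempty : Nonempty carrier
  str : PRestrictionSemigroup carrier

structure RegularCirc : Type (u + 1) where
  carrier : Type u
  nonempty : Nonempty carrier
  str : RegularCircSemigroup carrier

structure Restriction : Type (u + 1) where
  carrier : Type u
  nonempty : Nonempty carrier
  str : RestrictionSemigroup carrier

structure Inverse : Type (u + 1) where
  carrier : Type u
  nonempty : Nonempty carrier
  str : InverseSemigroup carrier

def GenRegularCirc.toDRS (S : GenRegularCirc.{u}) : DRS.{u} :=
  ⟨S.carrier, S.nonempty, S.str.toDRC⟩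

def PRestriction.toDRS (S : PRestriction.{u}) : DRS.{u} :=
  ⟨S.carrier, S.nonempty, S.str.toDRC⟩

def RegularCirc.toDRS (S : RegularCirc.{u}) : DRS.{u} :=
  ⟨S.carrier, S.nonempty, S.str.toGenRegular.toDRC⟩

def Restriction.toDRS (S : Restriction.{u}) : DRS.{u} :=
  ⟨S.carrier, S.nonempty, S.str.toDRC⟩

noncomputable def Inverse.toDRS (S : Inverse.{u}) : DRS.{u} :=
  ⟨S.carrier, S.nonempty, S.str.toRegularCirc.toGenRegular.toDRC⟩

/-- The category of generalized regular ∘-semigroups and maps that are (2,1,1)-homomorphisms for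
`x⁺ = x x°` and `x* = x° x`. -/
abbrev GenRegularCircCat : Type (u + 1) := InducedCategory DRS.{u} GenRegularCirc.toDRS

/-- The category of `P`-restriction semigroups and (2,1,1)-homomorphisms. -/
abbrev PRestrictionCat : Type (u + 1) := InducedCategory DRS.{u} PRestriction.toDRS

/-- The category of regular ∘-semigroups and maps that are (2,1,1)-homomorphisms for `x⁺ = x x°`
and `x* = x° x`. -/
abbrev RegularCircCat : Type (u + 1) := InducedCategory DRS.{u} RegularCirc.toDRS

/-- The category of restriction semigroups and (2,1,1)-homomorphisms. -/
abbrev RestrictionCat : Type (u + 1) := InducedCategory DRS.{u} Restriction.toDRS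

/-- The category of inverse semigroups and maps that are (2,1,1)-homomorphisms for
`x⁺ = x x⁻¹` and `x* = x⁻¹ x`. -/
abbrev InverseCat : Type (u + 1) := InducedCategory DRS.{u} Inverse.toDRS

/-! ### The correspondence -/

/-- `C` is the chain projection ordered category of the DRC-restriction semigroup `S`: it has the
same underlying set, `d x = x⁺`, `r x = x*`, `∘` is the restricted product, `≤` is the natural
partial order, `e × f = (e f)⁺`, `e ⋆ f = (e f)*` and `ε(p₁, …, p_k) = p₁ ⋯ p_k`. -/
def IsChainCatOf (S : DRS.{u}) (C : CPOC.{u}) : Prop :=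
  ∃ str : ChainProjectionOrderedCat S.carrier, C = ⟨S.carrier, S.nonempty, str⟩ ∧
    (∀ x : S.carrier, d x = x⁺ˢ) ∧
    (∀ x : S.carrier, r x = x∗ˢ) ∧
    (∀ (x y : S.carrier) (h : r x = d y), comp x y h = x * y) ∧
    (∀ x y : S.carrier, x ≤ y ↔ x = x⁺ˢ * y ∧ y⁺ˢ * x⁺ˢ * y⁺ˢ = x⁺ˢ) ∧
    (∀ e f : Obj S.carrier, (e ×ₚ f).1 = (e.1 * f.1)⁺ˢ) ∧
    (∀ e f : Obj S.carrier, (e ⋆ₚ f).1 = (e.1 * f.1)∗ˢ) ∧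
    (∀ p : PPath (Obj S.carrier),
      ChainProjectionOrderedCat.ε.toFun p = p.verts.tail.foldl (fun x q => x * q.1) p.dom.1)

/-- `S` is the DRC-restriction semigroup of the chain projection ordered category `C`: it has the
same underlying set, its product is `•`, and `x⁺ = d x`, `x* = r x`. -/
def IsSemigroupOf (C : CPOC.{u}) (S : DRS.{u}) : Prop :=
  ∃ str : DRCRestrictionSemigroup C.carrier, S = ⟨C.carrier, C.nonempty, str⟩ ∧
    (∀ x y : C.carrier, x * y = bullet x y) ∧
    (∀ x : C.carrier, x⁺ˢ = d x) ∧
    (∀ x : C.carrier, x∗ˢ = r x)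

/-- The functors `F : A ⥤ B` and `G : B ⥤ A` are mutually inverse. -/
def MutuallyInverse {A B : Type (u + 1)} [Category.{u} A] [Category.{u} B]
    (F : A ⥤ B) (G : B ⥤ A) : Prop :=
  F ⋙ G = 𝟭 A ∧ G ⋙ F = 𝟭 B

/-- `F` and `G` restrict, along `i : X ⥤ A` and `j : Y ⥤ B`, to mutually inverse functors between
`X` and `Y`. -/
def RestrictToIso {A B X Y : Type (u + 1)} [Category.{u} A] [Category.{u} B] [Category.{u} X]
    [Category.{u} Y] (F : A ⥤ B) (G : B ⥤ A) (i : X ⥤ A) (j : Y ⥤ B) : Prop :=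
  ∃ (F' : X ⥤ Y) (G' : Y ⥤ X), MutuallyInverse F' G' ∧ F' ⋙ j = i ⋙ F ∧ G' ⋙ i = j ⋙ G

end ChainPO

namespace ChainPO

open ArrowCat

/-! ### Arithmetic in DRC-restriction semigroups -/

section DRC

variable {S : Type u} [DRCRestrictionSemigroup S]

open DRCRestrictionSemigroup

/-! A product in a DRC-restriction semigroup factors through projections. With `p = (a* b⁺)⁺` and `q
= (a* b⁺)*` one has `p q = a* b⁺`, hence `a b = (a p)(p q)(q b)`, and adjacent factors are
composable in the restricted product. The multiplication is thus encoded by the restricted product,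
the restrictions `a p` and `q b`, and the products `p q` of `𝓕`-related projections, which are the
values of `ε`.

From semigroups to categories, the ample laws do the work. They turn left restriction by a
projection into right restriction, so the natural order is self-dual (`natLe_iff_ast`); they also
give the strong axioms and `G1`, where `x Θ_a = (x a)*` and `y Δ_a = (a y)⁺`. Both sides of the
linked pair condition equal `e b f` (`semigroup_lam`, `semigroup_rho`).

From categories to semigroups, the main point is associativity. Both bracketings of `a • b • c`
consist of a restriction of `a`, a middle part over `b`, and a restriction of `c`. The middle part
is `λ(e, b, f)` in one case and `ρ(e, b, f)` in the other, for the same linked pair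
(`bullet_bullet_left`, `bullet_bullet_right`), and `G2` says that they agree.

The constructions undo each other by the factorization above (`semigroup_bullet`,
`semigroupChainCat_chainSemigroup`). Maps are never changed, so equality of functors is reduced to
equality of objects by the faithful forgetful functors. The five restrictions concern full
subcategories. It suffices that groupoids, symmetric and commutative categories correspond to
`HasInverses`, `HasSymmetricProjections` and `HasCommutingProjections`, that these characterize the
classes of semigroups, and that `x°` is no extra datum because `x x°` and `x° x` determine it. -/

theorem plus_idem (x : S) : x⁺ˢ * x⁺ˢ = x⁺ˢ := by
  have := plus_mul_self x⁺ˢ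
  rwa [plus_plus] at this

theorem ast_idem (x : S) : x∗ˢ * x∗ˢ = x∗ˢ := by
  have := mul_ast_self x∗ˢ
  rwa [ast_ast] at this

theorem plus_mul_plus_mul (x y : S) : x⁺ˢ * (x * y)⁺ˢ = (x * y)⁺ˢ := by
  rw [plus_mul_eq x y, ← mul_assoc, ← mul_assoc, plus_idem]

theorem plus_mul_mul_plus (x y : S) : (x * y)⁺ˢ * x⁺ˢ = (x * y)⁺ˢ := by
  rw [plus_mul_eq x y, mul_assoc, plus_idem]

theorem ast_mul_ast_mul (x y : S) : y∗ˢ * (x * y)∗ˢ = (x * y)∗ˢ := by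
  rw [ast_mul_eq x y, ← mul_assoc, ← mul_assoc, ast_idem]

theorem ast_mul_mul_ast (x y : S) : (x * y)∗ˢ * y∗ˢ = (x * y)∗ˢ := by
  rw [ast_mul_eq x y, mul_assoc, ast_idem]

/-- Projections: the elements of the form `x⁺`, equivalently of the form `x*`. -/
def IsProj (e : S) : Prop := e⁺ˢ = e

theorem isProj_plus (x : S) : IsProj x⁺ˢ := plus_plus x

theorem isProj_ast (x : S) : IsProj x∗ˢ := ast_plus x

/-! ### Absorption laws for projections -/

namespace IsProj

variable {e f : S}

theorem ast_eq (he : IsProj e) : e∗ˢ = e := by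
  have h := plus_ast e
  rwa [he] at h

theorem idem (he : IsProj e) : e * e = e := by
  have h := plus_mul_self e
  rwa [he] at h

theorem mul_plus (he : IsProj e) (y : S) : e * (e * y)⁺ˢ = (e * y)⁺ˢ := by
  have h := plus_mul_plus_mul e y
  rwa [he] at h

theorem plus_mul (he : IsProj e) (y : S) : (e * y)⁺ˢ * e = (e * y)⁺ˢ := by
  have h := plus_mul_mul_plus e y
  rwa [he] at h

theorem mul_ast (hf : IsProj f) (x : S) : f * (x * f)∗ˢ = (x * f)∗ˢ := by
  have h := ast_mul_ast_mul x f
  rwa [hf.ast_eq] at h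

theorem ast_mul (hf : IsProj f) (x : S) : (x * f)∗ˢ * f = (x * f)∗ˢ := by
  have h := ast_mul_mul_ast x f
  rwa [hf.ast_eq] at h

/-- The projection `(e * y)⁺` absorbs `e` on its right, so it acts on `y` as it does on `e * y`,
which it fixes. -/
theorem plus_mul_cancel (he : IsProj e) (y : S) : (e * y)⁺ˢ * y = e * y := by
  rw [← he.plus_mul, mul_assoc, plus_mul_self]

theorem mul_ast_cancel (hf : IsProj f) (x : S) : x * (x * f)∗ˢ = x * f := by
  rw [← hf.mul_ast, ← mul_assoc, mul_ast_self]

end IsProj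

/-- The natural order of a DRC-restriction semigroup. -/
def NatLe (x y : S) : Prop := x = x⁺ˢ * y ∧ y⁺ˢ * x⁺ˢ * y⁺ˢ = x⁺ˢ

theorem natLe_iff (x y : S) :
    NatLe x y ↔ x = x⁺ˢ * y ∧ y⁺ˢ * x⁺ˢ = x⁺ˢ ∧ x⁺ˢ * y⁺ˢ = x⁺ˢ := by
  constructor
  · rintro ⟨h, h'⟩
    refine ⟨h, ?_, ?_⟩
    · rw [← h', ← mul_assoc, ← mul_assoc, plus_idem]
    · rw [← h', mul_assoc, plus_idem]
  · rintro ⟨h, h', h''⟩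
    exact ⟨h, by rw [h', h'']⟩

/-- The ample laws make the order left-right symmetric: `ample_ast` moves the restricting projection
`x⁺` across `y`, where it becomes `x*`, and `ample_plus` moves it back. -/
theorem natLe_iff_ast (x y : S) :
    NatLe x y ↔ x = y * x∗ˢ ∧ y∗ˢ * x∗ˢ = x∗ˢ ∧ x∗ˢ * y∗ˢ = x∗ˢ := by
  rw [natLe_iff]
  constructor
  · rintro ⟨h, h', h''⟩
    refine ⟨?_, ?_, ?_⟩
    · have h3 := ample_ast y x⁺ˢ
      rw [h'', ← h, plus_ast, ← h] at h3
      exact h3.symm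
    · have h3 := ast_mul_ast_mul x⁺ˢ y
      rwa [← h] at h3
    · have h3 := ast_mul_mul_ast x⁺ˢ y
      rwa [← h] at h3
  · rintro ⟨h, h', h''⟩
    refine ⟨?_, ?_, ?_⟩
    · have h3 := ample_plus y x∗ˢ
      rw [h', ← h, ast_plus, ← h] at h3
      exact h3.symm
    · have h3 := plus_mul_plus_mul y x∗ˢ
      rwa [← h] at h3
    · have h3 := plus_mul_mul_plus y x∗ˢ
      rwa [← h] at h3

theorem NatLe.refl (x : S) : NatLe x x :=
  (natLe_iff _ _).2 ⟨(plus_mul_self x).symm, plus_idem x, plus_idem x⟩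

theorem NatLe.trans {x y z : S} (h : NatLe x y) (h' : NatLe y z) : NatLe x z := by
  rw [natLe_iff] at *
  obtain ⟨h1, h2, h3⟩ := h
  obtain ⟨k1, k2, k3⟩ := h'
  refine ⟨?_, ?_, ?_⟩
  · rw [← h3, mul_assoc, ← k1, ← h1]
  · rw [← h2, ← mul_assoc, k2]
  · rw [← h3, mul_assoc, k3]

theorem NatLe.antisymm {x y : S} (h : NatLe x y) (h' : NatLe y x) : x = y := by
  rw [natLe_iff] at *
  have e : x⁺ˢ = y⁺ˢ := by rw [← h.2.2, h'.2.1]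
  rw [h.1, e, plus_mul_self]

theorem NatLe.plus {x y : S} (h : NatLe x y) : NatLe x⁺ˢ y⁺ˢ := by
  rw [natLe_iff] at *
  simp only [plus_plus]
  exact ⟨h.2.2.symm, h.2⟩

theorem NatLe.ast {x y : S} (h : NatLe x y) : NatLe x∗ˢ y∗ˢ := by
  rw [natLe_iff_ast] at *
  simp only [ast_ast]
  exact ⟨h.2.1.symm, h.2⟩

/-- The projection `(f * e)⁺` is fixed by `f` on both sides. The right-hand side is the order `PLe`
of the projection algebra. -/
theorem IsProj.natLe_iff {e f : S} (he : IsProj e) (hf : IsProj f) :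
    NatLe e f ↔ e = (f * e)⁺ˢ := by
  rw [ChainPO.natLe_iff, he, hf]
  constructor
  · rintro ⟨-, h, -⟩
    rw [h, he]
  · intro h
    have h1 := hf.plus_mul e
    have h2 := hf.mul_plus e
    rw [← h] at h1 h2
    exact ⟨h1.symm, h2, h1⟩

theorem plus_mul_of_ast_eq {x y : S} (h : x∗ˢ = y⁺ˢ) : (x * y)⁺ˢ = x⁺ˢ := by
  rw [DRCRestrictionSemigroup.plus_mul, ← h, mul_ast_self]

theorem ast_mul_of_ast_eq {x y : S} (h : x∗ˢ = y⁺ˢ) : (x * y)∗ˢ = y∗ˢ := by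
  rw [DRCRestrictionSemigroup.ast_mul, h, plus_mul_self]

theorem NatLe.mul {a b c e : S} (h : a∗ˢ = c⁺ˢ) (h' : b∗ˢ = e⁺ˢ) (hab : NatLe a b)
    (hce : NatLe c e) : NatLe (a * c) (b * e) := by
  rw [natLe_iff] at *
  rw [plus_mul_of_ast_eq h, plus_mul_of_ast_eq h']
  refine ⟨?_, hab.2⟩
  rw [← mul_assoc, ← hab.1]
  -- Here `a * c = a * c⁺ * e`, and `c⁺ = a*` is absorbed by `a`.
  conv_lhs => rw [hce.1, ← h, ← mul_assoc, mul_ast_self]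

theorem plus_restrict {p a : S} (hp : IsProj p) (h : p * a⁺ˢ = p) : (p * a)⁺ˢ = p := by
  rw [DRCRestrictionSemigroup.plus_mul, h, hp]

theorem ast_restrict {q a : S} (hq : IsProj q) (h : a∗ˢ * q = q) : (a * q)∗ˢ = q := by
  rw [DRCRestrictionSemigroup.ast_mul, h, hq.ast_eq]

theorem natLe_plus_mul {p a : S} (hp : IsProj p) (h : NatLe p a⁺ˢ) : NatLe (p * a) a := by
  rw [natLe_iff, hp, plus_plus] at h
  rw [natLe_iff, plus_restrict hp h.2.2]
  exact ⟨rfl, h.2⟩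

theorem natLe_mul_ast {q a : S} (hq : IsProj q) (h : NatLe q a∗ˢ) : NatLe (a * q) a := by
  rw [natLe_iff_ast, hq.ast_eq, ast_ast] at h
  rw [natLe_iff_ast, ast_restrict hq h.2.1]
  exact ⟨rfl, h.2⟩

/-! ### The projection ordered category of a DRC-restriction semigroup -/

variable (S) in
/-- The arrows are the elements, and composition is the restricted product. -/
@[reducible]
def semigroupArrowCat : ArrowCat S where
  d x := x⁺ˢ
  r x := x∗ˢ
  comp x y _ := x * y
  d_comp _ _ h := plus_mul_of_ast_eq h
  r_comp _ _ h := ast_mul_of_ast_eq h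
  assoc a b c _ _ := mul_assoc a b c
  r_d := plus_ast
  d_r x := (ast_plus x).symm
  d_comp_self := plus_mul_self
  comp_r_self := mul_ast_self

attribute [local instance] semigroupArrowCat

theorem isProj_obj (p : Obj S) : IsProj p.1 := by
  obtain ⟨_, a, rfl⟩ := p
  exact isProj_plus a

-- The restrictions are `p * a` and `a * q`. Uniqueness is read off the order: `x ≤ a` says `x = x⁺
-- * a`, and dually `x = a * x*` by `natLe_iff_ast`.
variable (S) in
@[reducible]
def semigroupOrderedCat : OrderedCat S where
  toArrowCat := semigroupArrowCat S
  le := NatLe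
  le_refl := NatLe.refl
  le_trans _ _ _ := NatLe.trans
  le_antisymm _ _ := NatLe.antisymm
  O1_d _ _ := NatLe.plus
  O1_r _ _ := NatLe.ast
  O2 _ _ _ _ := NatLe.mul
  O3 a p h := by
    have hp := isProj_obj p
    refine ⟨p.1 * a, ⟨natLe_plus_mul hp h, ?_⟩, ?_⟩
    · have h' : NatLe p.1 a⁺ˢ := h
      rw [natLe_iff, hp, plus_plus] at h'
      exact plus_restrict hp h'.2.2
    · rintro x ⟨hx, hd⟩
      change NatLe _ _ at hx
      change x⁺ˢ = p.1 at hd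
      rw [← hd]
      exact hx.1
  O4 a q h := by
    have hq := isProj_obj q
    refine ⟨a * q.1, ⟨natLe_mul_ast hq h, ?_⟩, ?_⟩
    · have h' : NatLe q.1 a∗ˢ := h
      rw [natLe_iff_ast, hq.ast_eq, ast_ast] at h'
      exact ast_restrict hq h'.2.1
    · rintro x ⟨hx, hd⟩
      change NatLe _ _ at hx
      change x∗ˢ = q.1 at hd
      rw [← hd]
      exact ((natLe_iff_ast _ _).1 hx).1

-- Only `SP1` and `SP2` depend on the ample laws; for the other axioms the congruence laws
-- `plus_mul`, `ast_mul` and absorption of projections suffice.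
variable (S) in
@[reducible]
def semigroupProjectionAlgebra : StrongProjectionAlgebra (Obj S) where
  times e f := ⟨(e.1 * f.1)⁺ˢ, _, rfl⟩
  star e f := ⟨(e.1 * f.1)∗ˢ, (e.1 * f.1)∗ˢ, ast_plus _⟩
  L1 e := Subtype.ext (by
    have he := isProj_obj e
    change (e.1 * e.1)⁺ˢ = e.1
    rw [he.idem, he])
  L2 e f := Subtype.ext (by
    have he := isProj_obj e
    change ((e.1 * f.1)⁺ˢ * e.1)⁺ˢ = (e.1 * f.1)⁺ˢ
    rw [he.plus_mul, plus_plus])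
  L3 e f g := Subtype.ext (by
    have he := isProj_obj e
    change (e.1 * (f.1 * g.1)⁺ˢ)⁺ˢ = ((e.1 * f.1)⁺ˢ * (f.1 * g.1)⁺ˢ)⁺ˢ
    rw [← plus_mul, ← plus_mul, ← mul_assoc, ← mul_assoc, he.plus_mul_cancel])
  L4 e f g := Subtype.ext (by
    have he := isProj_obj e
    change ((e.1 * f.1)⁺ˢ * g.1)⁺ˢ = ((e.1 * f.1)⁺ˢ * (e.1 * g.1)⁺ˢ)⁺ˢ
    rw [← plus_mul _ (e.1 * g.1), ← mul_assoc, he.plus_mul])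
  R1 e := Subtype.ext (by
    have he := isProj_obj e
    change (e.1 * e.1)∗ˢ = e.1
    rw [he.idem, he.ast_eq])
  R2 e f := Subtype.ext (by
    have he := isProj_obj e
    change (f.1 * e.1)∗ˢ = (e.1 * (f.1 * e.1)∗ˢ)∗ˢ
    rw [he.mul_ast, ast_ast])
  R3 e f g := Subtype.ext (by
    have he := isProj_obj e
    change ((g.1 * f.1)∗ˢ * e.1)∗ˢ = ((g.1 * f.1)∗ˢ * (f.1 * e.1)∗ˢ)∗ˢ
    rw [← ast_mul, ← ast_mul, mul_assoc, mul_assoc, he.mul_ast_cancel])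
  R4 e f g := Subtype.ext (by
    have he := isProj_obj e
    change (g.1 * (f.1 * e.1)∗ˢ)∗ˢ = ((g.1 * e.1)∗ˢ * (f.1 * e.1)∗ˢ)∗ˢ
    rw [← ast_mul (g.1 * e.1), mul_assoc, he.mul_ast])
  P3_star e f g := Subtype.ext (by
    have hf := isProj_obj f
    change ((e.1 * (f.1 * g.1)⁺ˢ)∗ˢ * g.1)∗ˢ = ((e.1 * f.1)∗ˢ * g.1)∗ˢ
    rw [← ast_mul, ← ast_mul, mul_assoc, mul_assoc, hf.plus_mul_cancel])
  P3_times e f g := Subtype.ext (by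
    have hf := isProj_obj f
    change (g.1 * ((g.1 * f.1)∗ˢ * e.1)⁺ˢ)⁺ˢ = (g.1 * (f.1 * e.1)⁺ˢ)⁺ˢ
    rw [← plus_mul, ← plus_mul, ← mul_assoc, ← mul_assoc, hf.mul_ast_cancel])
  P4_times e f := Subtype.ext (by
    have he := isProj_obj e
    change ((e.1 * f.1)⁺ˢ * e.1)∗ˢ = (e.1 * f.1)⁺ˢ
    rw [he.plus_mul, plus_ast])
  P4_star e f := Subtype.ext (by
    have hf := isProj_obj f
    change (f.1 * (e.1 * f.1)∗ˢ)⁺ˢ = (e.1 * f.1)∗ˢ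
    rw [hf.mul_ast, ast_plus])
  SP1 e f g := Subtype.ext (by
    have he := isProj_obj e
    have hf := isProj_obj f
    change (e.1 * (((e.1 * f.1)⁺ˢ * g.1)⁺ˢ * f.1)∗ˢ)⁺ˢ = ((e.1 * f.1)⁺ˢ * g.1)⁺ˢ
    have hp := isProj_plus (e.1 * f.1)
    have h1 := hp.plus_mul g.1
    have hh := isProj_plus ((e.1 * f.1)⁺ˢ * g.1)
    generalize ((e.1 * f.1)⁺ˢ * g.1)⁺ˢ = h at h1 hh ⊢
    -- As `h` absorbs `(e * f)⁺` on its right, `h * (e * f) = h * f`. The ample law for `e * f` and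
    -- `h` then reads `e * (h * f)* = h * f`, and the right-hand side has domain `h`.
    have h2 : h * (e.1 * f.1) = h * f.1 := by
      rw [← h1, mul_assoc, mul_assoc, plus_mul_self, he.plus_mul_cancel]
    have h3 := ample_ast (e.1 * f.1) h
    rw [h1, hh.ast_eq, h2, mul_assoc, hf.mul_ast] at h3
    rw [h3, ← h2, plus_mul, h1, hh])
  SP2 e f g := Subtype.ext (by
    have he := isProj_obj e
    have hf := isProj_obj f
    change ((f.1 * (g.1 * (f.1 * e.1)∗ˢ)∗ˢ)⁺ˢ * e.1)∗ˢ = (g.1 * (f.1 * e.1)∗ˢ)∗ˢ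
    have hp := isProj_ast (f.1 * e.1)
    have h1 := hp.mul_ast g.1
    have hh := isProj_ast (g.1 * (f.1 * e.1)∗ˢ)
    generalize (g.1 * (f.1 * e.1)∗ˢ)∗ˢ = h at h1 hh ⊢
    have h2 : f.1 * e.1 * h = f.1 * h := by
      rw [← h1, ← mul_assoc, ← mul_assoc, mul_ast_self, he.mul_ast_cancel]
    have h3 := ample_plus (f.1 * e.1) h
    rw [h1, hh, h2, ← mul_assoc, hf.plus_mul] at h3
    rw [h3, ← h2, ast_mul, h1, hh.ast_eq])

variable (S) in
@[reducible]
def semigroupWeakProjectionOrderedCat : WeakProjectionOrderedCat S where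
  toOrderedCat := semigroupOrderedCat S
  alg := semigroupProjectionAlgebra S
  le_iff p q := ((isProj_obj p).natLe_iff (isProj_obj q)).trans
    ⟨fun h => Subtype.ext h, fun h => congrArg Subtype.val h⟩

end DRC

/-! ### Restrictions in ordered categories -/

section Ordered

variable {C : Type u} [OrderedCat C]

theorem eq_lres {p : Obj C} {a x : C} (h : p.1 ≤ d a) (hx : x ≤ a) (hd : d x = p.1) :
    x = lres p a h :=
  (OrderedCat.O3 a p h).unique ⟨hx, hd⟩ ⟨lres_le p a h, d_lres p a h⟩

theorem eq_rres {a x : C} {q : Obj C} (h : q.1 ≤ r a) (hx : x ≤ a) (hr : r x = q.1) :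
    x = rres a q h :=
  (OrderedCat.O4 a q h).unique ⟨hx, hr⟩ ⟨rres_le a q h, r_rres a q h⟩

theorem eq_of_le_of_d_eq {a x y : C} (hx : x ≤ a) (hy : y ≤ a) (h : d x = d y) : x = y :=
  (OrderedCat.O3 a (dObj y) (OrderedCat.O1_d _ _ hy)).unique ⟨hx, h⟩ ⟨hy, rfl⟩

theorem eq_of_le_of_r_eq {a x y : C} (hx : x ≤ a) (hy : y ≤ a) (h : r x = r y) : x = y :=
  (OrderedCat.O4 a (rObj y) (OrderedCat.O1_r _ _ hy)).unique ⟨hx, h⟩ ⟨hy, rfl⟩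

end Ordered

/-! ### The chain projection ordered category of a DRC-restriction semigroup -/

section DRC

variable {S : Type u} [DRCRestrictionSemigroup S]

open DRCRestrictionSemigroup

section

attribute [local instance] semigroupWeakProjectionOrderedCat

theorem semigroup_lres (p : Obj S) (a : S) (h : p.1 ≤ d a) : lres p a h = p.1 * a := by
  have h1 : NatLe (lres p a h) a := lres_le p a h
  have h2 : (lres p a h)⁺ˢ = p.1 := d_lres p a h
  rw [h1.1, h2]

theorem semigroup_rres (a : S) (q : Obj S) (h : q.1 ≤ r a) : rres a q h = a * q.1 := by
  have h1 : NatLe (rres a q h) a := rres_le a q h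
  have h2 : (rres a q h)∗ˢ = q.1 := r_rres a q h
  rw [((natLe_iff_ast _ _).1 h1).1, h2]

theorem semigroup_Theta (a : S) (x : Obj S) : (Theta a x).1 = (x.1 * a)∗ˢ := by
  refine (congrArg (fun z : S => z∗ˢ) (semigroup_lres _ _ _)).trans ?_
  change ((x.1 * a⁺ˢ)∗ˢ * a)∗ˢ = _
  rw [← ast_mul, mul_assoc, plus_mul_self]

theorem semigroup_Delta (a : S) (y : Obj S) : (Delta a y).1 = (a * y.1)⁺ˢ := by
  refine (congrArg (fun z : S => z⁺ˢ) (semigroup_rres _ _ _)).trans ?_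
  change (a * (a∗ˢ * y.1)⁺ˢ)⁺ˢ = _
  rw [← plus_mul, ← mul_assoc, mul_ast_self]

variable (S) in
@[reducible]
noncomputable def semigroupProjectionOrderedCat : ProjectionOrderedCat S where
  toWeakProjectionOrderedCat := semigroupWeakProjectionOrderedCat S
  G1_delta a p t := Subtype.ext (by
    change ((Theta a p).1 * t.1)⁺ˢ = _
    rw [semigroup_Theta, semigroup_Theta]
    change _ = ((p.1 * (Delta a t).1)⁺ˢ * a)∗ˢ
    rw [semigroup_Delta, ← plus_mul, ← mul_assoc]
    -- This becomes `(p * a * t)⁺ * a = p * a * ((p * a)* * t)⁺`; the claim compares the ranges of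
    -- the two sides.
    have h := ample_plus (p.1 * a) t.1
    have hp := isProj_obj p
    rw [← mul_assoc, mul_assoc p.1, hp.plus_mul, ← mul_assoc] at h
    rw [h, ast_mul (p.1 * a), (isProj_ast _).mul_plus, plus_ast])
  G1_theta a p t := Subtype.ext (by
    change (t.1 * (Delta a p).1)∗ˢ = _
    rw [semigroup_Delta, semigroup_Delta]
    change _ = (a * ((Theta a t).1 * p.1)∗ˢ)⁺ˢ
    rw [semigroup_Theta, ← ast_mul, mul_assoc]
    have h := ample_ast (a * p.1) t.1
    have hp := isProj_obj p
    rw [mul_assoc, ← mul_assoc t.1, hp.mul_ast, mul_assoc] at h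
    rw [h, plus_mul _ (a * p.1), (isProj_plus _).ast_mul, ast_plus])

end

attribute [local instance] semigroupProjectionOrderedCat

/-- The product of the vertices of a path. -/
noncomputable def pathProd (p : PPath (Obj S)) : S := p.verts.tail.foldl (fun x q => x * q.1) p.dom.1

/-- The invariant is that the partial product has the last vertex `q` as its range. Since `q = q ×
s` and `s = q ⋆ s`, multiplying by the next vertex `s` keeps the domain and moves the range to `s`.
-/
theorem plus_foldl_of_isChain (l : List (Obj S)) (x : S) (q : Obj S) (h : x∗ˢ = q.1)
    (hl : (q :: l).IsChain PF) : (l.foldl (fun x q => x * q.1) x)⁺ˢ = x⁺ˢ := by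
  induction l generalizing x q with
  | nil => rfl
  | cons s l ih =>
    rw [List.isChain_cons_cons] at hl
    have h1 : q.1 = (q.1 * s.1)⁺ˢ := congrArg Subtype.val hl.1.1
    have h2 : s.1 = (q.1 * s.1)∗ˢ := congrArg Subtype.val hl.1.2
    rw [List.foldl_cons, ih (x * s.1) s (by rw [ast_mul, h, ← h2]) hl.2]
    rw [← mul_ast_self x, h, mul_assoc, plus_mul, ← h1]

theorem ast_foldl_of_isChain (l : List (Obj S)) (x : S) (q : Obj S) (h : x∗ˢ = q.1)
    (hl : (q :: l).IsChain PF) :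
    (l.foldl (fun x q => x * q.1) x)∗ˢ = ((q :: l).getLast (by simp)).1 := by
  induction l generalizing x q with
  | nil => exact h
  | cons s l ih =>
    rw [List.isChain_cons_cons] at hl
    have h2 : s.1 = (q.1 * s.1)∗ˢ := congrArg Subtype.val hl.1.2
    rw [List.foldl_cons, ih (x * s.1) s (by rw [ast_mul, h, ← h2]) hl.2]
    simp

theorem foldl_mul_left (l : List (Obj S)) (x y : S) :
    l.foldl (fun x q => x * q.1) (x * y) = x * l.foldl (fun x q => x * q.1) y := by
  induction l generalizing y with
  | nil => rfl
  | cons s l ih => rw [List.foldl_cons, List.foldl_cons, mul_assoc, ih]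

theorem plus_pathProd (p : PPath (Obj S)) : (pathProd p)⁺ˢ = p.dom.1 := by
  obtain ⟨l, hl, hc⟩ := p
  cases l with
  | nil => exact absurd rfl hl
  | cons q l =>
    exact (plus_foldl_of_isChain l q.1 q (isProj_obj q).ast_eq hc).trans (isProj_obj q)

theorem ast_pathProd (p : PPath (Obj S)) : (pathProd p)∗ˢ = p.cod.1 := by
  obtain ⟨l, hl, hc⟩ := p
  cases l with
  | nil => exact absurd rfl hl
  | cons q l => exact ast_foldl_of_isChain l q.1 q (isProj_obj q).ast_eq hc

/-- The vertex common to both paths occurs once in the concatenation and twice in the product, but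
the first product absorbs its own range. -/
theorem pathProd_comp (p q : PPath (Obj S)) (h : p.cod = q.dom) :
    pathProd (p.comp q h) = pathProd p * pathProd q := by
  have h1 := mul_ast_self (pathProd p)
  rw [ast_pathProd, h] at h1
  obtain ⟨l, hl, hc⟩ := p
  cases l with
  | nil => exact absurd rfl hl
  | cons s l =>
    conv_rhs => rw [pathProd.eq_1 q, ← foldl_mul_left, h1]
    exact List.foldl_append

/-- The product of `_r⇃(q₁, …, q_k)` is `r` times that of `(q₁, …, q_k)`. -/
theorem foldl_scanl (l : List (Obj S)) (x : S) (s q : Obj S) (h : x∗ˢ = s.1) (hs : s.1 * q.1 = s.1)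
    (hl : (q :: l).IsChain PF) :
    (l.scanl (· ⋆ₚ ·) s).tail.foldl (fun x q => x * q.1) x = l.foldl (fun x q => x * q.1) x := by
  induction l generalizing x q s with
  | nil => rfl
  | cons t l ih =>
    rw [List.isChain_cons_cons] at hl
    have ht := isProj_obj t
    have hst : (s ⋆ₚ t).1 = (s.1 * t.1)∗ˢ := rfl
    -- As `x` absorbs its range `s`, one has `x * (s * t)* = x * s * (s * t)* = x * s * t = x * t`.
    -- Hence a restricted vertex may be replaced by the original one.
    have h1 : x * (s ⋆ₚ t).1 = x * t.1 := by
      rw [← mul_ast_self x, h, hst, mul_assoc, mul_assoc, ht.mul_ast_cancel]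
    have key := ih (x * t.1) (s ⋆ₚ t) t (by rw [ast_mul, h, hst]) (by rw [hst, ht.ast_mul]) hl.2
    rw [List.scanl_cons, List.foldl_cons, ← key, ← h1]
    cases l <;> simp

theorem pathProd_le {p q : PPath (Obj S)} (h : p.Le q) : pathProd p ≤ pathProd q := by
  obtain ⟨s, hs, hp⟩ := h
  have hs' : NatLe s.1 q.dom.1 := (WeakProjectionOrderedCat.le_iff s q.dom).2 hs
  rw [natLe_iff, isProj_obj, isProj_obj] at hs'
  obtain ⟨l, hl, hc⟩ := q
  cases l with
  | nil => exact absurd rfl hl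
  | cons t l =>
    change s.1 = s.1 * t.1 ∧ t.1 * s.1 = s.1 ∧ s.1 * t.1 = s.1 at hs'
    have hp0 : p.dom = s := by
      have : p.verts.head? = some s := by rw [hp]; cases l <;> simp
      unfold PPath.dom
      rw [List.head?_eq_some_head p.ne_nil] at this
      simpa using this
    have h1 : pathProd p = s.1 * pathProd (⟨t :: l, hl, hc⟩ : PPath (Obj S)) := by
      rw [pathProd, hp0, hp]
      exact (foldl_scanl l s.1 s t (isProj_obj s).ast_eq hs'.2.2 hc).trans
        ((congrArg (fun z => l.foldl (fun x q => x * q.1) z) hs'.1).trans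
          (foldl_mul_left l s.1 t.1))
    have h2 : (pathProd p)⁺ˢ = s.1 := by rw [plus_pathProd, hp0]
    have h3 := plus_pathProd (⟨t :: l, hl, hc⟩ : PPath (Obj S))
    change NatLe _ _
    rw [natLe_iff, h2, h3]
    exact ⟨h1, hs'.2⟩

variable (S) in
noncomputable def semigroupEvaluation : EvaluationMap S where
  toFun := pathProd
  E1_single _ := rfl
  E1_pair p := (isProj_obj p).idem
  E2_d := plus_pathProd
  E2_r := ast_pathProd
  E3 := pathProd_comp
  E4 _ _ := pathProd_le

/-- All projections inserted between `e`, `b` and `f` are absorbed. The same happens in `ρ`, which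
yields `G2`. -/
theorem semigroup_lam (b : S) (e f : Obj S) (h : IsLinkedPair b e f) :
    lam (semigroupEvaluation S) b e f h = e.1 * b * f.1 := by
  have h1 : lam (semigroupEvaluation S) b e f h =
      e.1 * (e ⋆ₚ dObj b).1 * ((e ⋆ₚ dObj b).1 * b) * ((Theta b e).1 * f.1) :=
    congrArg (fun z => e.1 * (e ⋆ₚ dObj b).1 * z * ((Theta b e).1 * f.1)) (semigroup_lres _ _ _)
  have h2 : (e ⋆ₚ dObj b).1 = (e.1 * b⁺ˢ)∗ˢ := rfl
  rw [h1, semigroup_Theta, h2, (isProj_plus b).mul_ast_cancel,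
    ← mul_assoc (e.1 * b⁺ˢ), mul_assoc e.1 b⁺ˢ _, (isProj_plus b).mul_ast,
    (isProj_plus b).mul_ast_cancel, mul_assoc e.1, plus_mul_self, ← mul_assoc, mul_ast_self]

theorem semigroup_rho (b : S) (e f : Obj S) (h : IsLinkedPair b e f) :
    rho (semigroupEvaluation S) b e f h = e.1 * b * f.1 := by
  have h1 : rho (semigroupEvaluation S) b e f h =
      e.1 * (Delta b f).1 * (b * (rObj b ×ₚ f).1) * ((rObj b ×ₚ f).1 * f.1) :=
    congrArg (fun z => e.1 * (Delta b f).1 * z * ((rObj b ×ₚ f).1 * f.1)) (semigroup_rres _ _ _)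
  have h2 : (rObj b ×ₚ f).1 = (b∗ˢ * f.1)⁺ˢ := rfl
  have h3 : b * ((b∗ˢ * f.1)⁺ˢ * (b∗ˢ * f.1)) = b * f.1 := by
    rw [plus_mul_self, ← mul_assoc, mul_ast_self]
  rw [h1, semigroup_Delta, h2, (isProj_ast b).plus_mul_cancel, mul_assoc,
    mul_assoc, mul_assoc b, h3, plus_mul_self, mul_assoc]

variable (S) in
/-- The chain projection ordered category of a DRC-restriction semigroup. -/
@[reducible]
noncomputable def semigroupChainCat : ChainProjectionOrderedCat S where
  toProjectionOrderedCat := semigroupProjectionOrderedCat S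
  ε := semigroupEvaluation S
  G2 b e f h := (semigroup_lam b e f h).trans (semigroup_rho b e f h).symm

end DRC

/-! ### Projection algebra identities -/

section Algebra

variable {P : Type u} [ProjectionAlgebra P]

open ProjectionAlgebra

theorem star_star_of_ple {w D y : P} (h : PLe w D) : w ⋆ₚ (D ⋆ₚ y) = w ⋆ₚ y := by
  have h1 := R3 y D w
  rw [h.star_eq] at h1
  exact h1.symm

theorem times_times_of_ple {x D w : P} (h : PLe w D) : (x ×ₚ D) ×ₚ w = x ×ₚ w := by
  have h0 : w = D ×ₚ w := h
  have h1 := L3 x D w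
  rw [← h0] at h1
  exact h1.symm

theorem times_ple_times {x D w : P} (h : PLe w D) : PLe (x ×ₚ w) (x ×ₚ D) := by
  change _ = _
  rw [← L4, times_times_of_ple h]

/-- This is `SP2`, with `D ⋆ y` and `y` interchangeable to the right of elements below `D`. It finds
the target of the path `(D × y, D ⋆ y)` restricted to the source `D × (z ⋆ y)`, and is the point
where strongness enters associativity. -/
theorem times_star_of_ple {P : Type u} [StrongProjectionAlgebra P] {z D : P} (h : PLe z D)
    (y : P) : (D ×ₚ (z ⋆ₚ y)) ⋆ₚ (D ⋆ₚ y) = z ⋆ₚ y := by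
  have h1 := StrongProjectionAlgebra.SP2 y D z
  rw [star_star_of_ple h] at h1
  rw [star_star_of_ple (times_ple _ _), h1]

end Algebra

/-! ### Restrictions -/

theorem comp_congr {C : Type u} [ArrowCat C] {a a' b b' : C} (h : r a = d b) (h' : r a' = d b')
    (ha : a = a') (hb : b = b') : comp a b h = comp a' b' h' := by
  subst ha hb
  rfl

/-! ### Reassociation of five composable arrows -/

section Arrows

variable {C : Type u} [ArrowCat C] {u x b y w : C}

theorem comp_assoc_left (h₁ : r u = d x) (h₂ : r x = d b) (h₃ : r b = d y) (h₄ : r y = d w) :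
    comp (comp (comp (comp u x h₁) b ((r_comp _ _ _).trans h₂)) y ((r_comp _ _ _).trans h₃)) w
        ((r_comp _ _ _).trans h₄) =
      comp (comp u (comp (comp x b h₂) y ((r_comp _ _ _).trans h₃))
        (h₁.trans (((d_comp _ _ _).trans (d_comp _ _ _)).symm))) w
        ((r_comp _ _ _).trans ((r_comp _ _ _).trans h₄)) := by
  refine comp_congr _ _ ?_ rfl
  rw [← assoc u (comp x b h₂) y (h₁.trans (d_comp _ _ _).symm)]
  exact comp_congr _ _ (assoc _ _ _ _ _) rfl

theorem comp_assoc_right (h₁ : r u = d x) (h₂ : r x = d b) (h₃ : r b = d y) (h₄ : r y = d w) :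
    comp (comp u x h₁) (comp (comp b y h₃) w ((r_comp _ _ _).trans h₄))
        ((r_comp _ _ _).trans (h₂.trans ((d_comp _ _ _).trans (d_comp _ _ _)).symm)) =
      comp (comp u (comp (comp x b h₂) y ((r_comp _ _ _).trans h₃))
        (h₁.trans (((d_comp _ _ _).trans (d_comp _ _ _)).symm))) w
        ((r_comp _ _ _).trans ((r_comp _ _ _).trans h₄)) := by
  rw [← comp_assoc_left h₁ h₂ h₃ h₄, ← assoc (comp u x h₁) (comp b y h₃) w
    ((r_comp _ _ _).trans (h₂.trans (d_comp _ _ _).symm))]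
  exact comp_congr _ _ (assoc _ _ _ _ _).symm rfl

end Arrows

section Ordered

variable {C : Type u} [OrderedCat C]

theorem lres_mono {p q : Obj C} {a : C} (hp : p.1 ≤ d a) (hq : q.1 ≤ d a) (h : p.1 ≤ q.1) :
    lres p a hp ≤ lres q a hq := by
  have h1 : p.1 ≤ d (lres q a hq) := by rwa [d_lres]
  rw [← eq_lres hp ((lres_le p _ h1).trans (lres_le q a hq)) (d_lres p _ h1)]
  exact lres_le p _ h1

theorem rres_mono {p q : Obj C} {a : C} (hp : p.1 ≤ r a) (hq : q.1 ≤ r a) (h : p.1 ≤ q.1) :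
    rres a p hp ≤ rres a q hq := by
  have h1 : p.1 ≤ r (rres a q hq) := by rwa [r_rres]
  rw [← eq_rres hp ((rres_le _ p h1).trans (rres_le a q hq)) (r_rres _ p h1)]
  exact rres_le _ p h1

theorem r_obj (p : Obj C) : r p.1 = p.1 := by
  obtain ⟨_, a, rfl⟩ := p
  exact r_d a

end Ordered

/-! ### The semigroup of a chain projection ordered category -/

section Chain

variable {C : Type u} [ChainProjectionOrderedCat C]

open ChainProjectionOrderedCat ProjectionAlgebra ProjectionOrderedCat

/-- `u ∘ ε(p, q) ∘ v` for an arrow `u` with target `p` and an arrow `v` with source `q`. -/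
def bridge (u v : C) (p q : Obj C) (h : PF p q) (hu : r u = p.1) (hv : d v = q.1) : C :=
  comp (comp u (ε.two p q h) (hu.trans (EvaluationMap.d_two _ _ _ _).symm)) v
    ((r_comp _ _ _).trans ((EvaluationMap.r_two _ _ _ _).trans hv.symm))

theorem bridge_congr {u u' v v' : C} {p p' q q' : Obj C} {h : PF p q} {hu : r u = p.1}
    {hv : d v = q.1} {h' : PF p' q'} {hu' : r u' = p'.1} {hv' : d v' = q'.1} (h1 : u = u')
    (h2 : v = v') (h3 : p = p') (h4 : q = q') :
    bridge u v p q h hu hv = bridge u' v' p' q' h' hu' hv' := by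
  subst h1 h2 h3 h4
  rfl

theorem d_bridge (u v : C) (p q : Obj C) (h hu hv) : d (bridge u v p q h hu hv) = d u :=
  (d_comp _ _ _).trans (d_comp _ _ _)

theorem r_bridge (u v : C) (p q : Obj C) (h hu hv) : r (bridge u v p q h hu hv) = r v :=
  r_comp _ _ _

theorem bridge_le {u u' v v' : C} {p p' q q' : Obj C} {h : PF p q} {hu : r u = p.1}
    {hv : d v = q.1} {h' : PF p' q'} {hu' : r u' = p'.1} {hv' : d v' = q'.1} (h1 : u ≤ u')
    (h2 : v ≤ v') (h3 : (ε.two p q h : C) ≤ ε.two p' q' h') :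
    bridge u v p q h hu hv ≤ bridge u' v' p' q' h' hu' hv' :=
  OrderedCat.O2 _ _ _ _ _ _ (OrderedCat.O2 _ _ _ _ _ _ h1 h3) h2

/-- Identities may be dropped from `u ∘ ε(p, p) ∘ v`. -/
theorem bridge_self_left (v : C) (p : Obj C) (hu hv) :
    bridge p.1 v p p (PF_refl p) hu hv = v := by
  have h1 : (ε.two p p (PF_refl p) : C) = p.1 := ε.E1_pair p
  have hd : p.1 = d v := hv.symm
  have hr : r p.1 = d p.1 := by rw [d_obj, r_obj]
  have h2 : comp p.1 p.1 hr = p.1 :=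
    (comp_congr hr (r_d p.1) (d_obj p).symm rfl).trans (d_comp_self p.1)
  exact (comp_congr _ ((r_d v)) ((comp_congr _ hr rfl h1).trans (h2.trans hd)) rfl).trans
    (d_comp_self v)

theorem bridge_self_right (u : C) (p : Obj C) (hu hv) :
    bridge u p.1 p p (PF_refl p) hu hv = u := by
  have h1 : (ε.two p p (PF_refl p) : C) = p.1 := ε.E1_pair p
  have h2 : comp u p.1 (hu.trans (d_obj p).symm) = u :=
    (comp_congr _ (d_r u) rfl hu.symm).trans (comp_r_self u)
  exact (comp_congr _ (hu.trans (d_obj p).symm) ((comp_congr _ _ rfl h1).trans h2) rfl).trans h2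

/-- Restrictions are unique, so `u` and `v` are recognized by lying below `a` and `b` and having the
right end points. This allows products to be computed from any such arrows instead of the chosen
restrictions. -/
theorem bullet_eq_bridge {a b u v : C} (hu : u ≤ a) (hv : v ≤ b) {p q : Obj C} (h : PF p q)
    (hp : p = rObj a ×ₚ dObj b) (hq : q = rObj a ⋆ₚ dObj b) (hu' : r u = p.1)
    (hv' : d v = q.1) : bullet a b = bridge u v p q h hu' hv' := by
  subst hp hq
  exact (bridge_congr (h := h) (hu' := r_rres _ _ _) (hv' := d_lres _ _ _) (eq_rres _ hu hu')
    (eq_lres _ hv hv') rfl rfl).symm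

theorem dObj_bullet (a b : C) : dObj (bullet a b) = Delta a (dObj b) :=
  Subtype.ext (d_bridge _ _ _ _ (PF_times_star _ _) (r_rres _ _ _) (d_lres _ _ _))

theorem rObj_bullet (a b : C) : rObj (bullet a b) = Theta b (rObj a) :=
  Subtype.ext (r_bridge _ _ _ _ (PF_times_star _ _) (r_rres _ _ _) (d_lres _ _ _))

theorem two_le_two {p q s : Obj C} (h : PF p q) (hs : PLe s p) {t : Obj C} (h' : PF s t)
    (ht : t = s ⋆ₚ q) : (ε.two s t h' : C) ≤ ε.two p q h := by
  subst ht
  exact ε.E4 _ _ ⟨s, hs, rfl⟩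

/-- By `G1` the elements `Theta b e` and `Delta b f` of this pair are `Theta b x × y` and `x ⋆ Delta
b y`, and `s × t 𝓕 s ⋆ t` always holds. For `x = r a` and `y = d c` these are the end points of the
middle part of `a • b • c`. -/
theorem isLinkedPair (b : C) (x y : Obj C) :
    IsLinkedPair b (x ×ₚ Delta b y) (Theta b x ⋆ₚ y) where
  right := by
    rw [← G1_delta]
    exact (PF_times_star _ _).2
  left := by
    rw [← G1_theta]
    exact (PF_times_star _ _).1

theorem r_lam (b : C) (e f : Obj C) (h) : r (lam ε b e f h) = f.1 :=
  (r_comp _ _ _).trans (EvaluationMap.r_two _ _ _ _)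

theorem d_lam (b : C) (e f : Obj C) (h) : d (lam ε b e f h) = e.1 :=
  (d_comp _ _ _).trans ((d_comp _ _ _).trans (EvaluationMap.d_two _ _ _ _))

theorem r_rho (b : C) (e f : Obj C) (h) : r (rho ε b e f h) = f.1 :=
  (r_comp _ _ _).trans (EvaluationMap.r_two _ _ _ _)

theorem d_rho (b : C) (e f : Obj C) (h) : d (rho ε b e f h) = e.1 :=
  (d_comp _ _ _).trans ((d_comp _ _ _).trans (EvaluationMap.d_two _ _ _ _))

/-- The factors of `a • b`, cut down so that the first one ends in `e`, compose to an arrow below `a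
• b` with range `Theta b e = r (a • b) × d c`. This is the restriction of `a • b` that its product
with `c` requires; all that lies between `u` and `w` is then `λ(e, b, f)`. -/
theorem bullet_bullet_left (a b c : C) {u w : C} {e f : Obj C} (h : IsLinkedPair b e f)
    (he : e = rObj a ×ₚ Delta b (dObj c)) (hf : f = Theta b (rObj a) ⋆ₚ dObj c)
    (hua : u ≤ a) (hwc : w ≤ c) (hu : r u = e.1) (hw : d w = f.1) :
    bullet (bullet a b) c = comp (comp u (lam ε b e f h) (hu.trans (d_lam b e f h).symm)) w
      ((r_comp _ _ _).trans ((r_lam b e f h).trans hw.symm)) := by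
  have hΘ : Theta b e = Theta b (rObj a) ×ₚ dObj c := by rw [he, G1_delta]
  have hea : PLe e (rObj a) := by rw [he]; exact times_ple _ _
  have hep : PLe e (rObj a ×ₚ dObj b) := by rw [he]; exact times_ple_times (Delta_ple _ _)
  have hpq : (ε.two e (e ⋆ₚ dObj b) h.PF_e₁ : C) ≤
      ε.two (rObj a ×ₚ dObj b) (rObj a ⋆ₚ dObj b) (PF_times_star _ _) :=
    two_le_two _ hep _ (star_star_of_ple hea).symm
  have hq : (e ⋆ₚ dObj b).1 ≤ (rObj a ⋆ₚ dObj b).1 := by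
    have := OrderedCat.O1_r _ _ hpq
    rwa [EvaluationMap.r_two, EvaluationMap.r_two] at this
  have hleU : u ≤ rres a (rObj a ×ₚ dObj b) (le_of_ple (times_ple _ _)) := by
    rw [eq_rres (le_of_ple hea) hua hu]
    exact rres_mono _ _ (le_of_ple hep)
  have hU : bridge u (lres (e ⋆ₚ dObj b) b (le_of_ple (star_ple _ _))) e (e ⋆ₚ dObj b) h.PF_e₁ hu
      (d_lres _ _ _) ≤ bullet a b :=
    bridge_le (h' := PF_times_star _ _) (hu' := r_rres _ _ _) (hv' := d_lres _ _ _) hleU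
      (lres_mono _ _ hq) hpq
  rw [bullet_eq_bridge hU hwc h.PF_f₁ (by rw [rObj_bullet, hΘ]) (by rw [rObj_bullet, hf])
    (r_bridge _ _ _ _ _ _ _) hw]
  exact comp_assoc_left (hu.trans (EvaluationMap.d_two _ _ _ _).symm)
    ((EvaluationMap.r_two _ _ _ _).trans (d_lres _ _ _).symm)
    (EvaluationMap.d_two ε (Theta b e) f h.PF_f₁).symm
    ((EvaluationMap.r_two _ _ _ _).trans hw.symm)

/-- The argument mirrors `bullet_bullet_left`, but paths are ordered by restricting their sources,
so the duality is not formal: that the restricted path ends in `f` relies on `times_star_of_ple`. -/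
theorem bullet_bullet_right (a b c : C) {u w : C} {e f : Obj C} (h : IsLinkedPair b e f)
    (he : e = rObj a ×ₚ Delta b (dObj c)) (hf : f = Theta b (rObj a) ⋆ₚ dObj c)
    (hua : u ≤ a) (hwc : w ≤ c) (hu : r u = e.1) (hw : d w = f.1) :
    bullet a (bullet b c) = comp (comp u (rho ε b e f h) (hu.trans (d_rho b e f h).symm)) w
      ((r_comp _ _ _).trans ((r_rho b e f h).trans hw.symm)) := by
  have hΔ : Delta b f = rObj a ⋆ₚ Delta b (dObj c) := by rw [hf, G1_theta]
  have hfc : PLe f (dObj c) := by rw [hf]; exact star_ple _ _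
  have hfp : PLe (rObj b ×ₚ f) (rObj b ×ₚ dObj c) := times_ple_times hfc
  have hfq : f = (rObj b ×ₚ f) ⋆ₚ (rObj b ⋆ₚ dObj c) := by
    rw [hf, times_star_of_ple (Theta_ple _ _)]
  have hpq : (ε.two (rObj b ×ₚ f) f h.PF_f₂ : C) ≤
      ε.two (rObj b ×ₚ dObj c) (rObj b ⋆ₚ dObj c) (PF_times_star _ _) :=
    two_le_two _ hfp _ hfq
  have hq : f.1 ≤ (rObj b ⋆ₚ dObj c).1 := by
    have := OrderedCat.O1_r _ _ hpq
    rwa [EvaluationMap.r_two, EvaluationMap.r_two] at this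
  have hleW : w ≤ lres (rObj b ⋆ₚ dObj c) c (le_of_ple (star_ple _ _)) := by
    rw [eq_lres (le_of_ple hfc) hwc hw]
    exact lres_mono _ _ hq
  have hW : bridge (rres b (rObj b ×ₚ f) (le_of_ple (times_ple _ _))) w (rObj b ×ₚ f) f h.PF_f₂
      (r_rres _ _ _) hw ≤ bullet b c :=
    bridge_le (h' := PF_times_star _ _) (hu' := r_rres _ _ _) (hv' := d_lres _ _ _)
      (rres_mono _ _ (le_of_ple hfp)) hleW hpq
  rw [bullet_eq_bridge hua hW h.PF_e₂ (by rw [dObj_bullet, he]) (by rw [dObj_bullet, hΔ])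
    hu (d_bridge _ _ _ _ _ _ _)]
  exact comp_assoc_right (hu.trans (EvaluationMap.d_two _ _ _ _).symm)
    (EvaluationMap.r_two _ _ _ _) ((r_rres _ _ _).trans (EvaluationMap.d_two _ _ _ _).symm)
    ((EvaluationMap.r_two _ _ _ _).trans hw.symm)

theorem bullet_assoc (a b c : C) : bullet (bullet a b) c = bullet a (bullet b c) := by
  have he : PLe (rObj a ×ₚ Delta b (dObj c)) (rObj a) := times_ple _ _
  have hf : PLe (Theta b (rObj a) ⋆ₚ dObj c) (dObj c) := star_ple _ _
  have h := isLinkedPair b (rObj a) (dObj c)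
  rw [bullet_bullet_left a b c h rfl rfl (rres_le a _ (le_of_ple he)) (lres_le _ c (le_of_ple hf))
      (r_rres _ _ _) (d_lres _ _ _),
    bullet_bullet_right a b c h rfl rfl (rres_le a _ (le_of_ple he)) (lres_le _ c (le_of_ple hf))
      (r_rres _ _ _) (d_lres _ _ _)]
  exact comp_congr _ _ (comp_congr _ _ rfl (G2 _ _ _ _)) rfl

/-- For `p` below `d a` both vertices of the connecting path are `p`, so its value is an identity
and only the restriction of `a` remains. -/
theorem obj_bullet_of_le {p : Obj C} {a : C} (h : p.1 ≤ d a) :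
    bullet p.1 a = lres p a h := by
  have h0 : PLe p (dObj a) := (WeakProjectionOrderedCat.le_iff p (dObj a)).1 h
  have hr : rObj p.1 = p := Subtype.ext (r_obj p)
  rw [bullet_eq_bridge (le_refl p.1) (lres_le p a h) (PF_refl p) (by rw [hr, h0.times_eq])
    (by rw [hr, h0.star_eq]) (r_obj p) (d_lres _ _ _), bridge_self_left]

theorem bullet_obj_of_le {q : Obj C} {a : C} (h : q.1 ≤ r a) :
    bullet a q.1 = rres a q h := by
  have h0 : PLe q (rObj a) := (WeakProjectionOrderedCat.le_iff q (rObj a)).1 h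
  have hd : dObj q.1 = q := Subtype.ext (d_obj q)
  rw [bullet_eq_bridge (rres_le a q h) (le_refl q.1) (PF_refl q) (by rw [hd]; exact h0)
    (by rw [hd, h0.star_eq']) (r_rres _ _ _) (d_obj q), bridge_self_right]

theorem obj_bullet_obj_of_le {p q : Obj C} (h : p.1 ≤ q.1) : bullet p.1 q.1 = p.1 := by
  have h' : p.1 ≤ d q.1 := by rwa [d_obj]
  rw [obj_bullet_of_le h', ← eq_lres h' h (d_obj p)]

theorem obj_bullet_obj_of_ge {p q : Obj C} (h : p.1 ≤ q.1) : bullet q.1 p.1 = p.1 := by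
  have h' : p.1 ≤ r q.1 := by rwa [r_obj]
  rw [bullet_obj_of_le h', ← eq_rres h' h (r_obj p)]

theorem d_bullet_self (a : C) : bullet (d a) a = a :=
  (obj_bullet_of_le (p := dObj a) le_rfl).trans (eq_lres (p := dObj a) _ le_rfl rfl).symm

theorem bullet_r_self (a : C) : bullet a (r a) = a :=
  (bullet_obj_of_le (q := rObj a) le_rfl).trans (eq_rres (q := rObj a) _ le_rfl rfl).symm

theorem d_bullet (a b : C) : d (bullet a b) = (Delta a (dObj b)).1 :=
  congrArg Subtype.val (dObj_bullet a b)

theorem r_bullet (a b : C) : r (bullet a b) = (Theta b (rObj a)).1 :=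
  congrArg Subtype.val (rObj_bullet a b)

theorem dObj_d (a : C) : dObj (d a) = dObj a := Subtype.ext (d_obj (dObj a))

theorem rObj_r (a : C) : rObj (r a) = rObj a := Subtype.ext (r_obj (rObj a))

theorem Theta_d (b : C) (x : Obj C) : Theta (d b) x = x ⋆ₚ dObj b := by
  have h : (x ⋆ₚ dObj (d b)).1 ≤ d b := by
    rw [dObj_d]
    exact le_of_ple (star_ple x (dObj b))
  have h1 := eq_of_le_of_d_eq (lres_le (x ⋆ₚ dObj (d b)) (d b) (le_of_ple (star_ple _ _))) h
    ((d_lres _ _ _).trans (d_obj _).symm)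
  refine Subtype.ext ((congrArg r h1).trans ?_)
  rw [r_obj, dObj_d]

theorem Delta_r (a : C) (y : Obj C) : Delta (r a) y = rObj a ×ₚ y := by
  have h : (rObj (r a) ×ₚ y).1 ≤ r a := by
    rw [rObj_r]
    exact le_of_ple (times_ple (rObj a) y)
  have h1 := eq_of_le_of_r_eq (rres_le (r a) (rObj (r a) ×ₚ y) (le_of_ple (times_ple _ _))) h
    ((r_rres _ _ _).trans (r_obj _).symm)
  refine Subtype.ext ((congrArg d h1).trans ?_)
  rw [d_obj, rObj_r]

/-- Both sides are restrictions of `b` with range `Theta b (rObj a)`, and a restriction is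
determined by its range. This is one of the ample laws. -/
theorem bullet_r_bullet (a b : C) : bullet b (r (bullet a b)) = bullet (r (bullet a (d b))) b := by
  rw [r_bullet a (d b), Theta_d, r_bullet, bullet_obj_of_le (Theta_le _ _),
    obj_bullet_of_le (a := b) (le_of_ple (star_ple (rObj a) (dObj b)))]
  exact eq_of_le_of_r_eq (rres_le _ _ _) (lres_le _ _ _) (r_rres _ _ _)

theorem d_bullet_bullet (a b : C) : bullet (d (bullet a b)) a = bullet a (d (bullet (r a) b)) := by
  rw [d_bullet (r a) b, Delta_r, d_bullet, obj_bullet_of_le (Delta_le _ _),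
    bullet_obj_of_le (a := a) (le_of_ple (times_ple (rObj a) (dObj b)))]
  exact eq_of_le_of_d_eq (lres_le _ _ _) (rres_le _ _ _) (d_lres _ _ _)

variable (C) in
/-- The DRC-restriction semigroup of a chain projection ordered category. -/
@[reducible]
noncomputable def chainSemigroup : DRCRestrictionSemigroup C where
  mul := bullet
  mul_assoc := bullet_assoc
  plus := d
  ast := r
  plus_mul_self := d_bullet_self
  mul_ast_self := bullet_r_self
  plus_mul x y := by
    change d (bullet _ _) = d (bullet _ _)
    rw [d_bullet, d_bullet, dObj_d]
  ast_mul x y := by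
    change r (bullet _ _) = r (bullet _ _)
    rw [r_bullet, r_bullet, rObj_r]
  plus_mul_eq x y := by
    change d (bullet _ _) = bullet (bullet (dObj x).1 (d (bullet x y))) (dObj x).1
    rw [d_bullet, obj_bullet_obj_of_ge (q := dObj x) (Delta_le x (dObj y)),
      obj_bullet_obj_of_le (q := dObj x) (Delta_le x (dObj y))]
  ast_mul_eq x y := by
    change r (bullet _ _) = bullet (bullet (rObj y).1 (r (bullet x y))) (rObj y).1
    rw [r_bullet, obj_bullet_obj_of_ge (q := rObj y) (Theta_le y (rObj x)),
      obj_bullet_obj_of_le (q := rObj y) (Theta_le y (rObj x))]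
  plus_plus x := d_obj (dObj x)
  ast_ast x := r_obj (rObj x)
  plus_ast := r_d
  ast_plus x := (d_r x).symm
  ample_ast x y := bullet_r_bullet y x
  ample_plus x y := d_bullet_bullet x y

end Chain

/-! ### Extensionality -/

theorem DRCRestrictionSemigroup.ext_of_eq {S : Type u} (s t : DRCRestrictionSemigroup S)
    (hm : ∀ x y : S, s.mul x y = t.mul x y) (hp : ∀ x : S, s.plus x = t.plus x)
    (ha : ∀ x : S, s.ast x = t.ast x) : s = t := by
  rcases s with @⟨@⟨@⟨⟨ms⟩, _⟩, ps, as⟩⟩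
  rcases t with @⟨@⟨@⟨⟨mt⟩, _⟩, pt, bt⟩⟩
  obtain rfl : ms = mt := funext fun x => funext (hm x)
  obtain rfl : ps = pt := funext hp
  obtain rfl : as = bt := funext ha
  rfl

theorem ArrowCat.ext_of_eq {C : Type u} (s t : ArrowCat C) (hd : ∀ x, s.d x = t.d x)
    (hr : ∀ x, s.r x = t.r x) (hc : ∀ x y h h', s.comp x y h = t.comp x y h') : s = t := by
  rcases s with ⟨ds, rs, cs⟩
  rcases t with ⟨dt, rt, ct⟩
  obtain rfl : ds = dt := funext hd
  obtain rfl : rs = rt := funext hr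
  obtain rfl : cs = ct := funext fun x => funext fun y => funext fun h => hc x y h h
  rfl

theorem StrongProjectionAlgebra.ext_of_eq {P : Type u} (s t : StrongProjectionAlgebra P)
    (ht : ∀ x y : P, s.times x y = t.times x y) (hs : ∀ x y : P, s.star x y = t.star x y) :
    s = t := by
  rcases s with @⟨@⟨ts, ss⟩⟩
  rcases t with @⟨@⟨tt, st⟩⟩
  obtain rfl : ts = tt := funext fun x => funext (ht x)
  obtain rfl : ss = st := funext fun x => funext (hs x)
  rfl

theorem ChainProjectionOrderedCat.ext_of_eq {C : Type u} (s t : ChainProjectionOrderedCat C)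
    (hd : ∀ x, s.d x = t.d x) (hr : ∀ x, s.r x = t.r x)
    (hc : ∀ x y h h', s.comp x y h = t.comp x y h') (hle : ∀ x y, s.le x y ↔ t.le x y)
    (ht : ∀ (e f : @Obj C s.toArrowCat) (e' f' : @Obj C t.toArrowCat), e.1 = e'.1 → f.1 = f'.1 →
      (s.alg.times e f).1 = (t.alg.times e' f').1)
    (hs : ∀ (e f : @Obj C s.toArrowCat) (e' f' : @Obj C t.toArrowCat), e.1 = e'.1 → f.1 = f'.1 →
      (s.alg.star e f).1 = (t.alg.star e' f').1)
    (hε : ∀ (p : @PPath (@Obj C s.toArrowCat) s.alg.toProjectionAlgebra)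
      (p' : @PPath (@Obj C t.toArrowCat) t.alg.toProjectionAlgebra),
      (@PPath.verts _ s.alg.toProjectionAlgebra p).map Subtype.val =
        (@PPath.verts _ t.alg.toProjectionAlgebra p').map Subtype.val →
      @EvaluationMap.toFun C s.toProjectionOrderedCat s.ε p =
        @EvaluationMap.toFun C t.toProjectionOrderedCat t.ε p') : s = t := by
  rcases s with @⟨@⟨@⟨@⟨as, os⟩, ps⟩⟩, es⟩
  rcases t with @⟨@⟨@⟨@⟨bt, ot⟩, pt⟩⟩, et⟩
  obtain rfl : as = bt := ArrowCat.ext_of_eq _ _ hd hr hc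
  obtain rfl : os = ot := PartialOrder.ext hle
  obtain rfl : ps = pt := StrongProjectionAlgebra.ext_of_eq _ _
    (fun x y => Subtype.ext (ht x y x y rfl rfl)) (fun x y => Subtype.ext (hs x y x y rfl rfl))
  obtain rfl : es = et := EvaluationMap.ext (funext fun p => hε p p rfl)
  rfl

/-! ### From a semigroup to a category and back -/

section

variable {S : Type u} [DRCRestrictionSemigroup S]

open DRCRestrictionSemigroup

theorem plus_mul_ast_of_isProj {e f : S} (he : IsProj e) (hf : IsProj f) :
    (e * f)⁺ˢ * (e * f)∗ˢ = e * f := by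
  rw [← hf.mul_ast e, ← mul_assoc, he.plus_mul_cancel, mul_ast_self]

section

attribute [local instance] semigroupChainCat

theorem semigroup_bullet (a b : S) : bullet a b = a * b := by
  have h : bullet a b = (a * (rObj a ×ₚ dObj b).1) *
      ((rObj a ×ₚ dObj b).1 * (rObj a ⋆ₚ dObj b).1) * ((rObj a ⋆ₚ dObj b).1 * b) :=
    congrArg₂ (fun x y => x * ((rObj a ×ₚ dObj b).1 * (rObj a ⋆ₚ dObj b).1) * y)
      (semigroup_rres _ _ _) (semigroup_lres _ _ _)
  have h1 : (rObj a ×ₚ dObj b).1 = (a∗ˢ * b⁺ˢ)⁺ˢ := rfl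
  have h2 : (rObj a ⋆ₚ dObj b).1 = (a∗ˢ * b⁺ˢ)∗ˢ := rfl
  rw [h, h1, h2, mul_assoc a, ← mul_assoc (a∗ˢ * b⁺ˢ)⁺ˢ, plus_idem, mul_assoc,
    mul_assoc (a∗ˢ * b⁺ˢ)⁺ˢ, ← mul_assoc (a∗ˢ * b⁺ˢ)∗ˢ, ast_idem,
    ← mul_assoc (a∗ˢ * b⁺ˢ)⁺ˢ, plus_mul_ast_of_isProj (isProj_ast _) (isProj_plus _),
    mul_assoc a∗ˢ, plus_mul_self, ← mul_assoc, mul_ast_self]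

end

theorem chainSemigroup_semigroupChainCat {S : Type u} (s : DRCRestrictionSemigroup S) :
    @chainSemigroup S (semigroupChainCat S) = s :=
  DRCRestrictionSemigroup.ext_of_eq _ _ semigroup_bullet (fun _ => rfl) (fun _ => rfl)

/-- A (2,1,1)-homomorphism is a chain projection ordered functor. -/
noncomputable def BiunaryHom.toChainFunctor {T : Type u} [DRCRestrictionSemigroup T]
    (φ : BiunaryHom S T) :
    @ChainFunctor S T (semigroupChainCat S) (semigroupChainCat T) :=
  letI := semigroupChainCat S
  letI := semigroupChainCat T
  { toFun := φ.toFun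
    F1_d := fun a => (φ.map_plus a).symm
    F1_r := fun a => (φ.map_ast a).symm
    F2 := fun a b _ => φ.map_mul a b
    F3 := fun a b h => by
      have h' : NatLe a b := h
      change NatLe _ _
      refine ⟨?_, ?_⟩
      · rw [← φ.map_plus, ← φ.map_mul, ← h'.1]
      · rw [← φ.map_plus, ← φ.map_plus, ← φ.map_mul, ← φ.map_mul, h'.2]
    F4_times := fun e f => Subtype.ext <| by
      change φ.toFun (e.1 * f.1)⁺ˢ = (φ.toFun e.1 * φ.toFun f.1)⁺ˢ
      rw [φ.map_plus, φ.map_mul]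
    F4_star := fun e f => Subtype.ext <| by
      change φ.toFun (e.1 * f.1)∗ˢ = (φ.toFun e.1 * φ.toFun f.1)∗ˢ
      rw [φ.map_ast, φ.map_mul]
    F5 := fun p => by
      have key : ∀ (l : List (Obj S)) (x : S), φ.toFun (l.foldl (fun x q => x * q.1) x) =
          l.foldl (fun x q => x * φ.toFun q.1) (φ.toFun x) := by
        intro l
        induction l with
        | nil => exact fun _ => rfl
        | cons s l ih =>
          intro x
          rw [List.foldl_cons, List.foldl_cons, ih, φ.map_mul]
      obtain ⟨l, hl, hc⟩ := p
      cases l with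
      | nil => exact absurd rfl hl
      | cons q l =>
        change _ = (l.map (objMap φ.toFun fun a => (φ.map_plus a).symm)).foldl
          (fun x q => x * q.1) (φ.toFun q.1)
        rw [List.foldl_map]
        exact key l q.1 }

end

/-! ### From a category to a semigroup and back -/

section

variable {C D : Type u} [ChainProjectionOrderedCat C] [ChainProjectionOrderedCat D]

open ChainProjectionOrderedCat ProjectionAlgebra ProjectionOrderedCat

theorem bullet_eq_comp (x y : C) (h : r x = d y) : bullet x y = comp x y h := by
  have h' : rObj x = dObj y := Subtype.ext h
  have h1 : r (rObj x).1 = d y := by rw [r_obj]; exact h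
  rw [bullet_eq_bridge le_rfl le_rfl (PF_refl (rObj x)) (by rw [← h', L1]) (by rw [← h', R1]) rfl
    h.symm]
  refine comp_congr _ _ ?_ rfl
  exact (comp_congr _ (d_r x) rfl (ε.E1_pair (rObj x))).trans (comp_r_self x)

theorem bullet_obj_of_PF {x : C} {p q : Obj C} (h : PF p q) (hx : r x = p.1) :
    bullet x q.1 = comp x (ε.two p q h) (hx.trans (EvaluationMap.d_two _ _ _ _).symm) := by
  have hp : rObj x = p := Subtype.ext hx
  have hq : dObj q.1 = q := Subtype.ext (d_obj q)
  have hr : q.1 = r (comp x (ε.two p q h) (hx.trans (EvaluationMap.d_two _ _ _ _).symm)) :=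
    ((r_comp _ _ _).trans (EvaluationMap.r_two _ _ _ _)).symm
  rw [bullet_eq_bridge le_rfl le_rfl h (by rw [hp, hq, ← h.1]) (by rw [hp, hq, ← h.2]) hx (d_obj q)]
  exact (comp_congr _ (d_r _) rfl hr).trans (comp_r_self _)

theorem d_eval_cons (q : Obj C) (l : List (Obj C)) (h) (hl : (q :: l).IsChain PF) :
    d (ε.toFun ⟨q :: l, h, hl⟩) = q.1 :=
  ε.E2_d ⟨q :: l, h, hl⟩

theorem foldl_bullet (l : List (Obj C)) (q : Obj C) (x : C) (hx : r x = q.1)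
    (hl : (q :: l).IsChain PF) :
    l.foldl (fun x q => bullet x q.1) x =
      comp x (ε.toFun ⟨q :: l, by simp, hl⟩) (hx.trans (d_eval_cons _ _ _ _).symm) := by
  induction l generalizing q x with
  | nil =>
    have h : ε.toFun ⟨[q], by simp, hl⟩ = r x := (ε.E1_single q).trans hx.symm
    exact ((comp_congr _ (d_r x) rfl h).trans (comp_r_self x)).symm
  | cons s l ih =>
    have hl' := List.isChain_cons_cons.1 hl
    have h1 : r (bullet x s.1) = s.1 := by
      rw [bullet_obj_of_PF hl'.1 hx]
      exact (r_comp _ _ _).trans (EvaluationMap.r_two _ _ _ _)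
    have h2 := ε.E3 (.pair q s hl'.1) ⟨s :: l, by simp, hl'.2⟩ rfl
    rw [List.foldl_cons, ih s _ h1 hl'.2]
    refine (comp_congr _ ?_ (bullet_obj_of_PF hl'.1 hx) rfl).trans
      ((assoc _ _ _ _ ?_).trans (comp_congr _ _ rfl h2.symm))
    · exact (r_comp _ _ _).trans ((EvaluationMap.r_two _ _ _ _).trans (d_eval_cons _ _ _ _).symm)
    · exact (EvaluationMap.r_two _ _ _ _).trans (d_eval_cons _ _ _ _).symm

theorem foldl_bullet_eq (p : PPath (Obj C)) :
    p.verts.tail.foldl (fun x q => bullet x q.1) p.dom.1 = ε.toFun p := by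
  obtain ⟨l, hl, hc⟩ := p
  cases l with
  | nil => exact absurd rfl hl
  | cons q l =>
    refine (foldl_bullet l q q.1 (r_obj q) hc).trans ?_
    have h : q.1 = d (ε.toFun ⟨q :: l, hl, hc⟩) := (d_eval_cons _ _ _ _).symm
    exact (comp_congr _ (r_d _) h rfl).trans (d_comp_self _)

theorem le_iff_bullet (x y : C) :
    (x = bullet (d x) y ∧ bullet (bullet (d y) (d x)) (d y) = d x) ↔ x ≤ y := by
  constructor
  · rintro ⟨h1, h2⟩
    have h3 : d x ≤ d y := by
      have h4 := congrArg d h2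
      rw [bullet_assoc, d_bullet, show d (d x) = d x from d_obj (dObj x)] at h4
      have h5 := Delta_le (d y) (dObj (bullet (d x) (d y)))
      rw [h4] at h5
      exact h5.trans (d_obj (dObj y)).le
    have h4 := obj_bullet_of_le (p := dObj x) (a := y) h3
    rw [h1]
    exact h4.le.trans (lres_le _ _ _)
  · intro h
    have h3 : (dObj x).1 ≤ (dObj y).1 := OrderedCat.O1_d _ _ h
    refine ⟨?_, ?_⟩
    · exact (eq_lres (p := dObj x) h3 h rfl).trans (obj_bullet_of_le (p := dObj x) h3).symm
    · change bullet (bullet (dObj y).1 (dObj x).1) (dObj y).1 = (dObj x).1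
      rw [obj_bullet_obj_of_ge h3, obj_bullet_obj_of_le h3]

theorem d_obj_bullet_obj (e f : Obj C) : d (bullet e.1 f.1) = (e ×ₚ f).1 := by
  have h := Delta_r e.1 f
  have he : rObj e.1 = e := Subtype.ext (r_obj e)
  have hf : dObj f.1 = f := Subtype.ext (d_obj f)
  rw [r_obj, he] at h
  rw [d_bullet, hf, h]

theorem r_obj_bullet_obj (e f : Obj C) : r (bullet e.1 f.1) = (e ⋆ₚ f).1 := by
  have h := Theta_d f.1 e
  have he : rObj e.1 = e := Subtype.ext (r_obj e)
  have hf : dObj f.1 = f := Subtype.ext (d_obj f)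
  rw [d_obj, hf] at h
  rw [r_bullet, he, h]

theorem semigroupChainCat_chainSemigroup {C : Type u} (s : ChainProjectionOrderedCat C) :
    @semigroupChainCat C (chainSemigroup C) = s := by
  refine ChainProjectionOrderedCat.ext_of_eq _ _ (fun _ => rfl) (fun _ => rfl)
    (fun x y _ h => bullet_eq_comp x y h) le_iff_bullet ?_ ?_ ?_
  · rintro e f ⟨_, he⟩ ⟨_, hf⟩ rfl rfl
    exact d_obj_bullet_obj (C := C) ⟨e.1, he⟩ ⟨f.1, hf⟩
  · rintro e f ⟨_, he⟩ ⟨_, hf⟩ rfl rfl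
    exact r_obj_bullet_obj (C := C) ⟨e.1, he⟩ ⟨f.1, hf⟩
  · intro p p' h
    obtain ⟨l, hl, hc⟩ := p
    obtain rfl : l = p'.verts := List.map_injective_iff.2 Subtype.val_injective h
    exact foldl_bullet_eq p'

theorem map_bridge (φ : ChainFunctor C D) (u v : C) (p q : Obj C) (h hu hv) (h' hu' hv') :
    φ.toFun (bridge u v p q h hu hv) = bridge (φ.toFun u) (φ.toFun v)
      (objMap φ.toFun φ.F1_d p) (objMap φ.toFun φ.F1_d q) h' hu' hv' := by
  refine (φ.F2 _ _ _).trans (comp_congr _ _ ((φ.F2 _ _ _).trans (comp_congr _ _ rfl ?_)) rfl)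
  exact φ.F5 _

theorem map_bullet (φ : ChainFunctor C D) (a b : C) :
    φ.toFun (bullet a b) = bullet (φ.toFun a) (φ.toFun b) := by
  have hr : objMap φ.toFun φ.F1_d (rObj a) = rObj (φ.toFun a) := Subtype.ext (φ.F1_r a).symm
  have hd : objMap φ.toFun φ.F1_d (dObj b) = dObj (φ.toFun b) := Subtype.ext (φ.F1_d b).symm
  have h1 := φ.F4_times (rObj a) (dObj b)
  have h2 := φ.F4_star (rObj a) (dObj b)
  rw [hr, hd] at h1 h2
  have hPF : PF (objMap φ.toFun φ.F1_d (rObj a ×ₚ dObj b))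
      (objMap φ.toFun φ.F1_d (rObj a ⋆ₚ dObj b)) := by
    rw [h1, h2]
    exact PF_times_star _ _
  have hu : r (φ.toFun (rres a (rObj a ×ₚ dObj b) (le_of_ple (times_ple (rObj a) (dObj b))))) =
      (objMap φ.toFun φ.F1_d (rObj a ×ₚ dObj b)).1 :=
    (φ.F1_r _).trans (congrArg φ.toFun (r_rres _ _ _))
  have hv : d (φ.toFun (lres (rObj a ⋆ₚ dObj b) b (le_of_ple (star_ple (rObj a) (dObj b))))) =
      (objMap φ.toFun φ.F1_d (rObj a ⋆ₚ dObj b)).1 :=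
    (φ.F1_d _).trans (congrArg φ.toFun (d_lres _ _ _))
  exact (map_bridge φ _ _ _ _ (PF_times_star _ _) (r_rres _ _ _) (d_lres _ _ _) hPF hu hv).trans
    (bullet_eq_bridge (φ.F3 _ _ (rres_le _ _ _)) (φ.F3 _ _ (lres_le _ _ _)) hPF h1 h2 hu hv).symm

/-- A chain projection ordered functor is a (2,1,1)-homomorphism. -/
noncomputable def ChainFunctor.toBiunaryHom (φ : ChainFunctor C D) :
    @BiunaryHom C D (chainSemigroup C).toBiunarySemigroup (chainSemigroup D).toBiunarySemigroup :=
  letI := chainSemigroup C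
  letI := chainSemigroup D
  { toFun := φ.toFun
    map_mul := map_bullet φ
    map_plus := fun x => (φ.F1_d x).symm
    map_ast := fun x => (φ.F1_r x).symm }

end

/-! ### Classes of DRC-restriction semigroups -/

section

variable (S : Type u) [DRCRestrictionSemigroup S]

/-- Every element has an inverse in the category of the restricted product. -/
def HasInverses : Prop :=
  ∀ a : S, ∃ b : S, a∗ˢ = b⁺ˢ ∧ b∗ˢ = a⁺ˢ ∧ a * b = a⁺ˢ ∧ b * a = a∗ˢ

/-- `e × f = e f e` and `e ⋆ f = f e f` for all projections `e`, `f`. -/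
def HasSymmetricProjections : Prop :=
  ∀ x y : S, (x⁺ˢ * y⁺ˢ)⁺ˢ = x⁺ˢ * y⁺ˢ * x⁺ˢ ∧ (x⁺ˢ * y⁺ˢ)∗ˢ = y⁺ˢ * x⁺ˢ * y⁺ˢ

/-- Projections commute. -/
def HasCommutingProjections : Prop := ∀ x y : S, x⁺ˢ * y⁺ˢ = y⁺ˢ * x⁺ˢ

variable {S}

open DRCRestrictionSemigroup

section

attribute [local instance] semigroupChainCat

theorem isArrowGroupoid_iff : IsArrowGroupoid S ↔ HasInverses S :=
  ⟨fun h a => let ⟨b, h1, h2, h3, h4⟩ := h a; ⟨b, h1, h2, h3, h4⟩,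
    fun h a => let ⟨b, h1, h2, h3, h4⟩ := h a; ⟨b, h1, h2, h3, h4⟩⟩

theorem isCommutativeChain_iff : IsCommutativeChain S ↔ HasCommutingProjections S := by
  constructor
  · intro h
    have key : ∀ x y : S, x⁺ˢ * y⁺ˢ = (x⁺ˢ * y⁺ˢ)⁺ˢ := fun x y => by
      have h1 : (x⁺ˢ * y⁺ˢ)⁺ˢ = (y⁺ˢ * x⁺ˢ)⁺ˢ := congrArg Subtype.val (h (dObj x) (dObj y))
      have h2 := (isProj_plus y).plus_mul x⁺ˢ
      rwa [← h1, (isProj_plus x).plus_mul_cancel] at h2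
    intro x y
    rw [key x y, key y x]
    exact congrArg Subtype.val (h (dObj x) (dObj y))
  · intro h e f
    have h1 := h e.1 f.1
    rw [isProj_obj e, isProj_obj f] at h1
    exact Subtype.ext (congrArg (fun z : S => z⁺ˢ) h1)

theorem isSymmetricChain_iff : IsSymmetricChain S ↔ HasSymmetricProjections S := by
  constructor
  · rintro ⟨hs, hε⟩ x y
    have hPF := PF_times_star (dObj x) (dObj y)
    have h1 : (x⁺ˢ * y⁺ˢ)⁺ˢ = (y⁺ˢ * x⁺ˢ)∗ˢ := congrArg Subtype.val (hs (dObj x) (dObj y))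
    have h2 : (y⁺ˢ * x⁺ˢ)⁺ˢ = (x⁺ˢ * y⁺ˢ)∗ˢ := congrArg Subtype.val (hs (dObj y) (dObj x))
    have h3 : (x⁺ˢ * y⁺ˢ)⁺ˢ * (x⁺ˢ * y⁺ˢ)∗ˢ * (x⁺ˢ * y⁺ˢ)⁺ˢ = (x⁺ˢ * y⁺ˢ)⁺ˢ := hε _ _ hPF
    have h4 : (x⁺ˢ * y⁺ˢ)∗ˢ * (x⁺ˢ * y⁺ˢ)⁺ˢ * (x⁺ˢ * y⁺ˢ)∗ˢ = (x⁺ˢ * y⁺ˢ)∗ˢ :=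
      hε _ _ (hPF.symm_of_symmetric hs)
    have h5 : (x⁺ˢ * y⁺ˢ)⁺ˢ * (x⁺ˢ * y⁺ˢ)∗ˢ = x⁺ˢ * y⁺ˢ :=
      plus_mul_ast_of_isProj (isProj_plus x) (isProj_plus y)
    have h6 : (x⁺ˢ * y⁺ˢ)∗ˢ * (x⁺ˢ * y⁺ˢ)⁺ˢ = y⁺ˢ * x⁺ˢ := by
      rw [h1, ← h2]
      exact plus_mul_ast_of_isProj (isProj_plus y) (isProj_plus x)
    constructor
    · rw [← h3, mul_assoc, ← ast_idem (x⁺ˢ * y⁺ˢ), mul_assoc, h6, ← mul_assoc, h5, ← mul_assoc,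
        mul_assoc x⁺ˢ, plus_idem]
    · rw [← h4, mul_assoc, ← plus_idem (x⁺ˢ * y⁺ˢ), mul_assoc, h5, ← mul_assoc, h6, ← mul_assoc,
        mul_assoc y⁺ˢ, plus_idem]
  · intro h
    have key : ∀ e f : Obj S, (e ×ₚ f).1 = e.1 * f.1 * e.1 ∧ (e ⋆ₚ f).1 = f.1 * e.1 * f.1 :=
      fun e f => by
        have h1 := h e.1 f.1
        rwa [isProj_obj e, isProj_obj f] at h1
    refine ⟨fun e f => Subtype.ext ((key e f).1.trans (key f e).2.symm), fun p q hPF => ?_⟩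
    exact ((key p q).1.symm.trans (congrArg Subtype.val hPF.1.symm) : p.1 * q.1 * p.1 = p.1)

end

theorem HasCommutingProjections.plus_eq (h : HasCommutingProjections S) (x y : S) :
    (x⁺ˢ * y⁺ˢ)⁺ˢ = x⁺ˢ * y⁺ˢ := by
  have h2 := (isProj_plus y).plus_mul x⁺ˢ
  rwa [← h x y, (isProj_plus x).plus_mul_cancel, eq_comm] at h2

theorem HasCommutingProjections.ast_eq (h : HasCommutingProjections S) (x y : S) :
    (x⁺ˢ * y⁺ˢ)∗ˢ = x⁺ˢ * y⁺ˢ := by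
  rw [← h.plus_eq, plus_ast]

theorem HasCommutingProjections.symmetric (h : HasCommutingProjections S) :
    HasSymmetricProjections S := fun x y => by
  constructor
  · rw [h.plus_eq, h x y, mul_assoc, plus_idem]
  · rw [h.ast_eq, h y x, mul_assoc, plus_idem]

/-! ### Restriction and `P`-restriction semigroups -/

theorem PRestrictionSemigroup.hasSymmetricProjections {S : Type u} (h : PRestrictionSemigroup S) :
    @HasSymmetricProjections S h.toDRC := fun x y => by
  refine ⟨h.plus_proj x y, ?_⟩
  have h1 := h.ast_proj x⁺ˢ y⁺ˢ
  rwa [h.plus_ast, h.plus_ast] at h1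

/-- A DRC-restriction semigroup with symmetric projections is `P`-restriction. -/
@[reducible]
def HasSymmetricProjections.toPRestriction (h : HasSymmetricProjections S) :
    PRestrictionSemigroup S where
  plus_mul_self := plus_mul_self
  plus_mul := plus_mul
  plus_proj x y := (h x y).1
  plus_idem := plus_idem
  plus_ast := plus_ast
  mul_ast_self := mul_ast_self
  ast_mul := ast_mul
  ast_proj x y := by
    have h1 := (h x∗ˢ y∗ˢ).2
    rwa [ast_plus, ast_plus] at h1
  ast_idem := ast_idem
  ast_plus := ast_plus
  ample_plus x y := by
    have h1 := (h x∗ˢ y).1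
    rw [ast_plus] at h1
    rw [ample_plus, plus_mul, h1, ← mul_assoc, ← mul_assoc, mul_ast_self]
  ample_ast x y := by
    have h1 := (h y∗ˢ x).2
    rw [ast_plus] at h1
    rw [ample_ast, ast_mul, h1, mul_assoc, plus_mul_self]

/-- A DRC-restriction semigroup with commuting projections is a restriction semigroup. -/
@[reducible]
def HasCommutingProjections.toRestriction (h : HasCommutingProjections S) :
    RestrictionSemigroup S :=
  have ha : ∀ x y : S, x∗ˢ * y∗ˢ = y∗ˢ * x∗ˢ := fun x y => by
    have h1 := h x∗ˢ y∗ˢ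
    rwa [ast_plus, ast_plus] at h1
  { plus_mul_self := plus_mul_self
    plus_comm := h
    plus_proj := fun x y => by rw [h.plus_eq, h]
    plus_mul_le := plus_mul_plus_mul
    plus_mul := plus_mul
    plus_ast := plus_ast
    mul_ast_self := mul_ast_self
    ast_comm := ha
    ast_proj := fun x y => by
      have h1 := h.ast_eq x∗ˢ y∗ˢ
      rw [ast_plus, ast_plus] at h1
      rw [h1, ha]
    ast_mul_le := ast_mul_mul_ast
    ast_mul := ast_mul
    ast_plus := ast_plus
    ample_plus := fun x y => by
      have h1 := h.plus_eq x∗ˢ y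
      rw [ast_plus] at h1
      rw [ample_plus, plus_mul, h1, ← mul_assoc, mul_ast_self]
    ample_ast := fun x y => by
      have h1 := h.ast_eq y∗ˢ x
      rw [ast_plus] at h1
      rw [ample_ast, ast_mul, h1, mul_assoc, plus_mul_self] }

/-! ### Regular and inverse semigroups -/

theorem GenRegularCircSemigroup.hasInverses {S : Type u} (h : GenRegularCircSemigroup S) :
    @HasInverses S h.toDRC := fun a => by
  have h1 := h.circ_circ a
  exact ⟨a°ˢ, (congrArg (a°ˢ * ·) h1).symm, congrArg (· * a°ˢ) h1, rfl, rfl⟩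

theorem inverse_eq {x a b : S} (h₁ : x * a = x⁺ˢ) (h₂ : b * x = x∗ˢ) (h₃ : x∗ˢ = a⁺ˢ)
    (h₄ : b∗ˢ = x⁺ˢ) : a = b := by
  rw [← plus_mul_self a, ← h₃, ← h₂, mul_assoc, h₁, ← h₄, mul_ast_self]

namespace HasInverses

variable (h : HasInverses S)

/-- The inverse of an element. -/
noncomputable def inv (x : S) : S := (h x).choose

theorem inv_plus (x : S) : (h.inv x)⁺ˢ = x∗ˢ := (h x).choose_spec.1.symm

theorem inv_ast (x : S) : (h.inv x)∗ˢ = x⁺ˢ := (h x).choose_spec.2.1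

theorem mul_inv (x : S) : x * h.inv x = x⁺ˢ := (h x).choose_spec.2.2.1

theorem inv_mul (x : S) : h.inv x * x = x∗ˢ := (h x).choose_spec.2.2.2

theorem inv_mul_plus (x : S) : h.inv x * x⁺ˢ = h.inv x := by
  rw [← h.inv_ast, mul_ast_self]

theorem ast_mul_inv (x : S) : x∗ˢ * h.inv x = h.inv x := by
  rw [← h.inv_plus, plus_mul_self]

theorem eq_inv {x a : S} (h₁ : x * a = x⁺ˢ) (h₂ : x∗ˢ = a⁺ˢ) : a = h.inv x :=
  inverse_eq h₁ (h.inv_mul x) h₂ (h.inv_ast x)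

/-- A DRC-restriction semigroup with inverses is a generalized regular ∘-semigroup. -/
@[reducible]
noncomputable def toGenRegular : GenRegularCircSemigroup S where
  circ := h.inv
  mul_circ_mul x := by rw [h.mul_inv, plus_mul_self]
  circ_circ x := (h.eq_inv (by rw [h.inv_mul, h.inv_plus]) (h.inv_ast x)).symm
  circ_mul_right x y := by
    rw [mul_assoc, h.mul_inv]
    conv_rhs => rw [← h.inv_mul_plus, mul_assoc, plus_mul_mul_plus, h.inv_mul_plus]
  circ_mul_left x y := by
    rw [h.inv_mul]
    conv_rhs => rw [← h.ast_mul_inv, ← mul_assoc, ast_mul_ast_mul, h.ast_mul_inv]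
  circ_mul_self x y := by
    have h1 : h.inv (x * y) * x * (x∗ˢ * y)⁺ˢ = h.inv (x * y) * x := by
      rw [mul_assoc, ← ample_plus, ← mul_assoc, h.inv_mul_plus]
    have h2 : h.inv (x * y) * x * (x∗ˢ * y) = (x∗ˢ * y)∗ˢ := by
      rw [mul_assoc, ← mul_assoc x, mul_ast_self, h.inv_mul, ast_mul]
    rw [h.inv_mul, ← h1, ← h.mul_inv (x∗ˢ * y), ← mul_assoc, h2, h.ast_mul_inv]

theorem inv_mul_rev (hs : HasSymmetricProjections S) (x y : S) :
    h.inv (x * y) = h.inv y * h.inv x := by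
  have e1 : x * y * (h.inv y * h.inv x) = (x * y)⁺ˢ := by
    have h1 := hs.toPRestriction.ample_plus x y
    have h2 : (x * y)⁺ˢ * x * h.inv x = x * y⁺ˢ * x∗ˢ * h.inv x := congrArg (· * h.inv x) h1
    rw [mul_assoc, h.mul_inv, plus_mul_mul_plus, mul_assoc (x * y⁺ˢ), h.ast_mul_inv] at h2
    rw [mul_assoc, ← mul_assoc y, h.mul_inv, ← mul_assoc, h2]
  have e2 : h.inv y * h.inv x * (x * y) = (x * y)∗ˢ := by
    have h1 := hs.toPRestriction.ample_ast y x
    have h2 : h.inv y * (y * (x * y)∗ˢ) = h.inv y * (y⁺ˢ * x∗ˢ * y) := congrArg (h.inv y * ·) h1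
    rw [← mul_assoc, h.inv_mul, ast_mul_ast_mul, mul_assoc y⁺ˢ, ← mul_assoc, h.inv_mul_plus] at h2
    rw [mul_assoc, ← mul_assoc (h.inv x), h.inv_mul, h2]
  have e3 : y⁺ˢ * x∗ˢ * (y⁺ˢ * x∗ˢ) = y⁺ˢ * x∗ˢ := by
    have h1 := (hs y x∗ˢ).1
    rw [ast_plus] at h1
    have h2 := plus_mul_self (y⁺ˢ * x∗ˢ)
    rwa [h1, ← mul_assoc, mul_assoc _ y⁺ˢ y⁺ˢ, plus_idem, mul_assoc _ y⁺ˢ x∗ˢ] at h2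
  have e4 : h.inv y * h.inv x * (x * y)⁺ˢ = h.inv y * h.inv x := by
    rw [← e1]
    calc h.inv y * h.inv x * (x * y * (h.inv y * h.inv x))
        = h.inv y * (h.inv x * x) * (y * h.inv y) * h.inv x := by simp only [mul_assoc]
      _ = (h.inv y * y⁺ˢ) * x∗ˢ * y⁺ˢ * (x∗ˢ * h.inv x) := by
          rw [h.inv_mul, h.mul_inv, h.inv_mul_plus, h.ast_mul_inv]
      _ = h.inv y * (y⁺ˢ * x∗ˢ * (y⁺ˢ * x∗ˢ)) * h.inv x := by simp only [mul_assoc]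
      _ = (h.inv y * y⁺ˢ) * (x∗ˢ * h.inv x) := by rw [e3]; simp only [mul_assoc]
      _ = h.inv y * h.inv x := by rw [h.inv_mul_plus, h.ast_mul_inv]
  rw [← e4, ← h.mul_inv (x * y), ← mul_assoc, e2, h.ast_mul_inv]

/-- A generalized regular ∘-semigroup with symmetric projections is a regular ∘-semigroup. -/
@[reducible]
noncomputable def toRegularCirc (hs : HasSymmetricProjections S) : RegularCircSemigroup S where
  toUnarySemigroup := h.toGenRegular.toUnarySemigroup
  mul_circ_mul := h.toGenRegular.mul_circ_mul
  circ_circ := h.toGenRegular.circ_circ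
  circ_mul := h.inv_mul_rev hs

theorem eq_plus_mul_ast_of_idem (h : HasInverses S) (hs : HasSymmetricProjections S) {e : S}
    (he : e * e = e) : e = e⁺ˢ * e∗ˢ := by
  have h1 := h.inv_mul_rev hs e e
  rw [he] at h1
  rw [← h.mul_inv, ← h.inv_mul, mul_assoc, ← mul_assoc (h.inv e), ← h1, h.inv_mul, mul_ast_self]

/-- A generalized regular ∘-semigroup with commuting projections is an inverse semigroup. -/
@[reducible]
noncomputable def toInverse (hc : HasCommutingProjections S) : InverseSemigroup S where
  regular x := ⟨h.inv x, by rw [h.mul_inv, plus_mul_self],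
    by rw [h.inv_mul, h.ast_mul_inv]⟩
  idem_comm e f he hf := by
    have key : ∀ e : S, e * e = e → ∃ x : S, e = x⁺ˢ := fun e he => by
      have h1 := h.eq_plus_mul_ast_of_idem hc.symmetric he
      have h2 := hc.plus_eq e e∗ˢ
      rw [ast_plus, ← h1] at h2
      exact ⟨e, h2.symm⟩
    obtain ⟨x, rfl⟩ := key e he
    obtain ⟨y, rfl⟩ := key f hf
    exact hc x y

end HasInverses

theorem RegularCircSemigroup.hasSymmetricProjections {S : Type u} (h : RegularCircSemigroup S) :
    @HasSymmetricProjections S h.toGenRegular.toDRC := fun x y => by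
  let := h.toGenRegular
  have hp : ∀ x : S, (x * x°ˢ)°ˢ = x * x°ˢ := GenRegularCircSemigroup.circ_plus
  have hi : ∀ x : S, x * x°ˢ * (x * x°ˢ) = x * x°ˢ := fun x => by
    rw [← mul_assoc, h.mul_circ_mul]
  constructor
  · change x * x°ˢ * (y * y°ˢ) * (x * x°ˢ * (y * y°ˢ))°ˢ = x * x°ˢ * (y * y°ˢ) * (x * x°ˢ)
    rw [h.circ_mul (x * x°ˢ), hp, hp, ← mul_assoc, mul_assoc (x * x°ˢ), hi]
  · change (x * x°ˢ * (y * y°ˢ))°ˢ * (x * x°ˢ * (y * y°ˢ)) = y * y°ˢ * (x * x°ˢ) * (y * y°ˢ)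
    rw [h.circ_mul (x * x°ˢ), hp, hp, ← mul_assoc, mul_assoc (y * y°ˢ), hi]

theorem InverseSemigroup.hasCommutingProjections {S : Type u} (h : InverseSemigroup S) :
    @HasCommutingProjections S h.toRegularCirc.toGenRegular.toDRC := fun x y => by
  refine h.idem_comm _ _ ?_ ?_
  · exact @plus_idem S h.toRegularCirc.toGenRegular.toDRC x
  · exact @plus_idem S h.toRegularCirc.toGenRegular.toDRC y

end

/-! ### Functors that agree after composition with a faithful functor -/

section Functors

universe v₁ v₂ v₃ u₁ u₂ u₃

theorem functor_eq_of_comp_eq {A : Type u₁} [Category.{v₁} A] {B : Type u₂} [Category.{v₂} B]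
    {D : Type u₃} [Category.{v₃} D] {H K : A ⥤ B} (U : B ⥤ D) [U.Faithful]
    (hobj : ∀ X, H.obj X = K.obj X) (h : H ⋙ U = K ⋙ U) : H = K := by
  refine CategoryTheory.Functor.ext hobj fun X Y f => U.map_injective ?_
  have h1 := Functor.congr_hom h f
  simp only [Functor.comp_map] at h1
  rw [h1, U.map_comp, U.map_comp, eqToHom_map, eqToHom_map]

variable {A B : Type (u + 1)} [Category.{u} A] [Category.{u} B]

/-- Mutually inverse functors restrict to the full subcategories that are given by the image of an
injective map `f : X → A` and by a property `Q` of objects of `B`, if these correspond. -/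
theorem MutuallyInverse.restrictToIso {F : A ⥤ B} {G : B ⥤ A} (hFG : MutuallyInverse F G)
    {X : Type (u + 1)} {f : X → A} (hf : Function.Injective f) {Q : ObjectProperty B}
    (h : ∀ a, Q (F.obj a) ↔ ∃ x, f x = a) :
    RestrictToIso F G (inducedFunctor f : InducedCategory A f ⥤ A) Q.ι := by
  have hF : ∀ x : InducedCategory A f, Q ((inducedFunctor f ⋙ F).obj x) := fun x => (h _).2 ⟨x, rfl⟩
  have hG : ∀ y : Q.FullSubcategory, ∃ x : X, f x = G.obj y.obj := fun y => by
    refine (h _).1 ?_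
    have h1 : F.obj (G.obj y.obj) = y.obj := Functor.congr_obj hFG.2 y.obj
    rw [h1]
    exact y.property
  choose g hg using hG
  let F' : InducedCategory A f ⥤ Q.FullSubcategory := Q.lift (inducedFunctor f ⋙ F) hF
  let G' : Q.FullSubcategory ⥤ InducedCategory A f :=
    { obj := g
      map := fun {y z} φ => InducedCategory.homMk
        (eqToHom (hg y) ≫ G.map φ.hom ≫ eqToHom (hg z).symm)
      map_id := fun y => by
        apply InducedCategory.hom_ext
        simp
      map_comp := fun φ ψ => by
        apply InducedCategory.hom_ext
        simp }
  have hF' : F' ⋙ Q.ι = inducedFunctor f ⋙ F := rfl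
  have hG' : G' ⋙ inducedFunctor f = Q.ι ⋙ G :=
    CategoryTheory.Functor.ext hg fun _ _ _ => rfl
  have e1 : (F' ⋙ G') ⋙ inducedFunctor f = 𝟭 _ ⋙ inducedFunctor f := by
    rw [Functor.assoc, hG', ← Functor.assoc, hF', Functor.assoc, hFG.1]
    rfl
  have e2 : (G' ⋙ F') ⋙ Q.ι = 𝟭 _ ⋙ Q.ι := by
    rw [Functor.assoc, hF', ← Functor.assoc, hG', Functor.assoc, hFG.2]
    rfl
  refine ⟨F', G', ⟨functor_eq_of_comp_eq (inducedFunctor f) (fun x => ?_) e1,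
    functor_eq_of_comp_eq Q.ι (fun y => ?_) e2⟩, hF', hG'⟩
  · exact hf (Functor.congr_obj e1 x)
  · exact ObjectProperty.FullSubcategory.ext (Functor.congr_obj e2 y)

end Functors

/-! ### The two functors -/

instance : DRS.underlying.{u}.Faithful where
  map_injective h := BiunaryHom.ext (funext fun x => ConcreteCategory.congr_hom h x)

instance : CPOC.underlying.{u}.Faithful where
  map_injective h := ChainFunctor.ext (funext fun x => ConcreteCategory.congr_hom h x)

/-- The functor `𝐂`. -/
noncomputable def toCPOC : DRS.{u} ⥤ CPOC.{u} where
  obj X := ⟨X.carrier, X.nonempty, semigroupChainCat X.carrier⟩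
  map φ := φ.toChainFunctor

/-- The functor `𝐒`. -/
noncomputable def toDRS : CPOC.{u} ⥤ DRS.{u} where
  obj Y := ⟨Y.carrier, Y.nonempty, chainSemigroup Y.carrier⟩
  map φ := φ.toBiunaryHom

theorem toCPOC_toDRS : MutuallyInverse toCPOC.{u} toDRS.{u} := by
  refine ⟨functor_eq_of_comp_eq DRS.underlying (fun X => ?_) rfl,
    functor_eq_of_comp_eq CPOC.underlying (fun Y => ?_) rfl⟩
  · exact congrArg (DRS.mk X.carrier X.nonempty) (chainSemigroup_semigroupChainCat X.str)
  · exact congrArg (CPOC.mk Y.carrier Y.nonempty) (semigroupChainCat_chainSemigroup Y.str)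

theorem isChainCatOf_toCPOC (X : DRS.{u}) : IsChainCatOf X (toCPOC.obj X) :=
  ⟨semigroupChainCat X.carrier, rfl, fun _ => rfl, fun _ => rfl, fun _ _ _ => rfl,
    fun _ _ => Iff.rfl, fun _ _ => rfl, fun _ _ => rfl, fun _ => rfl⟩

theorem isSemigroupOf_toDRS (Y : CPOC.{u}) : IsSemigroupOf Y (toDRS.obj Y) :=
  ⟨chainSemigroup Y.carrier, rfl, fun _ _ => rfl, fun _ => rfl, fun _ => rfl⟩

/-! ### The classes as full subcategories -/

theorem DRS.ext_of_eq (X : DRS.{u}) (s : DRCRestrictionSemigroup X.carrier)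
    (hm : ∀ x y, s.mul x y = X.str.mul x y) (hp : ∀ x, s.plus x = X.str.plus x)
    (ha : ∀ x, s.ast x = X.str.ast x) : (⟨X.carrier, X.nonempty, s⟩ : DRS) = X :=
  congrArg (DRS.mk X.carrier X.nonempty) (DRCRestrictionSemigroup.ext_of_eq s X.str hm hp ha)

theorem GenRegularCircSemigroup.toDRC_injective {S : Type u} :
    Function.Injective (GenRegularCircSemigroup.toDRC (S := S)) := by
  intro s t h
  have hm : s.toSemigroup = t.toSemigroup :=
    congrArg (fun z : DRCRestrictionSemigroup S => z.toSemigroup) h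
  have hs := @circ_mul_circ S s
  have ht := @circ_mul_circ S t
  rcases s with @⟨@⟨ms, cs⟩⟩
  rcases t with @⟨@⟨mt, ct⟩⟩
  obtain rfl : ms = mt := hm
  obtain rfl : cs = ct := by
    funext x
    have h1 : x * cs x = x * ct x :=
      congrArg (fun z : DRCRestrictionSemigroup S => z.plus x) h
    have h2 : cs x * x = ct x * x :=
      congrArg (fun z : DRCRestrictionSemigroup S => z.ast x) h
    have h3 : cs x * x * cs x = cs x := hs x
    have h4 : ct x * x * ct x = ct x := ht x
    rw [← h3, mul_assoc, h1, ← mul_assoc, h2, h4]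
  rfl

theorem GenRegularCirc.toDRS_injective : Function.Injective GenRegularCirc.toDRS.{u} := by
  rintro ⟨c, n, s⟩ ⟨c', n', s'⟩ h
  obtain ⟨rfl, h⟩ := DRS.mk.inj h
  obtain rfl := GenRegularCircSemigroup.toDRC_injective (eq_of_heq h)
  rfl

theorem RegularCirc.toDRS_injective : Function.Injective RegularCirc.toDRS.{u} := by
  rintro ⟨c, n, s⟩ ⟨c', n', s'⟩ h
  obtain ⟨rfl, h⟩ := DRS.mk.inj h
  have h1 : s.toUnarySemigroup = s'.toUnarySemigroup :=
    congrArg (fun z : GenRegularCircSemigroup c => z.toUnarySemigroup)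
      (GenRegularCircSemigroup.toDRC_injective (eq_of_heq h))
  rcases s with ⟨⟩
  rcases s' with ⟨⟩
  cases h1
  rfl

theorem PRestriction.toDRS_injective : Function.Injective PRestriction.toDRS.{u} := by
  rintro ⟨c, n, s⟩ ⟨c', n', s'⟩ h
  obtain ⟨rfl, h⟩ := DRS.mk.inj h
  have h1 : s.toBiunarySemigroup = s'.toBiunarySemigroup :=
    congrArg (fun z : DRCRestrictionSemigroup c => z.toBiunarySemigroup) (eq_of_heq h)
  rcases s with ⟨⟩
  rcases s' with ⟨⟩
  cases h1
  rfl

theorem Restriction.toDRS_injective : Function.Injective Restriction.toDRS.{u} := by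
  rintro ⟨c, n, s⟩ ⟨c', n', s'⟩ h
  obtain ⟨rfl, h⟩ := DRS.mk.inj h
  have h1 : s.toBiunarySemigroup = s'.toBiunarySemigroup :=
    congrArg (fun z : DRCRestrictionSemigroup c => z.toBiunarySemigroup) (eq_of_heq h)
  rcases s with ⟨⟩
  rcases s' with ⟨⟩
  cases h1
  rfl

theorem Inverse.toDRS_injective : Function.Injective Inverse.toDRS.{u} := by
  rintro ⟨c, n, s⟩ ⟨c', n', s'⟩ h
  obtain ⟨rfl, h⟩ := DRS.mk.inj h
  have h1 : s.toSemigroup = s'.toSemigroup :=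
    congrArg (fun z : DRCRestrictionSemigroup c => z.toSemigroup) (eq_of_heq h)
  rcases s with ⟨⟩
  rcases s' with ⟨⟩
  cases h1
  rfl

theorem isGroupoid_toCPOC_iff (X : DRS.{u}) :
    CPOC.isGroupoid (toCPOC.obj X) ↔ ∃ S : GenRegularCirc, S.toDRS = X := by
  refine (isArrowGroupoid_iff (S := X.carrier)).trans ⟨fun h => ?_, ?_⟩
  · exact ⟨⟨X.carrier, X.nonempty, h.toGenRegular⟩,
      X.ext_of_eq _ (fun _ _ => rfl) h.mul_inv h.inv_mul⟩
  · rintro ⟨S, rfl⟩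
    exact S.str.hasInverses

theorem isSymmetric_toCPOC_iff (X : DRS.{u}) :
    CPOC.isSymmetric (toCPOC.obj X) ↔ ∃ S : PRestriction, S.toDRS = X := by
  refine (isSymmetricChain_iff (S := X.carrier)).trans ⟨fun h => ?_, ?_⟩
  · exact ⟨⟨X.carrier, X.nonempty, h.toPRestriction⟩, rfl⟩
  · rintro ⟨S, rfl⟩
    exact S.str.hasSymmetricProjections

theorem isSymmetricGroupoid_toCPOC_iff (X : DRS.{u}) :
    CPOC.isSymmetricGroupoid (toCPOC.obj X) ↔ ∃ S : RegularCirc, S.toDRS = X := by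
  refine (and_congr (isSymmetricChain_iff (S := X.carrier))
    (isArrowGroupoid_iff (S := X.carrier))).trans ⟨fun h => ?_, ?_⟩
  · exact ⟨⟨X.carrier, X.nonempty, h.2.toRegularCirc h.1⟩,
      X.ext_of_eq _ (fun _ _ => rfl) h.2.mul_inv h.2.inv_mul⟩
  · rintro ⟨S, rfl⟩
    exact ⟨S.str.hasSymmetricProjections, S.str.toGenRegular.hasInverses⟩

theorem isCommutative_toCPOC_iff (X : DRS.{u}) :
    CPOC.isCommutative (toCPOC.obj X) ↔ ∃ S : Restriction, S.toDRS = X := by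
  refine (isCommutativeChain_iff (S := X.carrier)).trans ⟨fun h => ?_, ?_⟩
  · exact ⟨⟨X.carrier, X.nonempty, h.toRestriction⟩, rfl⟩
  · rintro ⟨S, rfl⟩
    exact S.str.plus_comm

theorem isCommutativeGroupoid_toCPOC_iff (X : DRS.{u}) :
    CPOC.isCommutativeGroupoid (toCPOC.obj X) ↔ ∃ S : Inverse, S.toDRS = X := by
  refine (and_congr (isCommutativeChain_iff (S := X.carrier))
    (isArrowGroupoid_iff (S := X.carrier))).trans ⟨fun h => ?_, ?_⟩
  · let := h.2.toInverse h.1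
    have hi : ∀ x : X.carrier, h.2.inv x = invElt x := fun x =>
      eq_invElt (h.2.toGenRegular.mul_circ_mul x) (by
        rw [h.2.inv_mul, h.2.ast_mul_inv])
    exact ⟨⟨X.carrier, X.nonempty, h.2.toInverse h.1⟩, X.ext_of_eq _ (fun _ _ => rfl)
      (fun x => (congrArg (x * ·) (hi x)).symm.trans (h.2.mul_inv x))
      (fun x => (congrArg (· * x) (hi x)).symm.trans (h.2.inv_mul x))⟩
  · rintro ⟨S, rfl⟩
    exact ⟨S.str.hasCommutingProjections, S.str.toRegularCirc.toGenRegular.hasInverses⟩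

end ChainPO

theorem theorem6p9 :
    ∃ (C : ChainPO.DRS.{u} ⥤ ChainPO.CPOC.{u}) (S : ChainPO.CPOC.{u} ⥤ ChainPO.DRS.{u}),
      ChainPO.MutuallyInverse C S ∧
      C ⋙ ChainPO.CPOC.underlying = ChainPO.DRS.underlying ∧
      S ⋙ ChainPO.DRS.underlying = ChainPO.CPOC.underlying ∧
      (∀ X, ChainPO.IsChainCatOf X (C.obj X)) ∧
      (∀ Y, ChainPO.IsSemigroupOf Y (S.obj Y)) ∧
      ChainPO.RestrictToIso C S
        (inducedFunctor ChainPO.GenRegularCirc.toDRS : ChainPO.GenRegularCircCat.{u} ⥤ ChainPO.DRS.{u})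
        ChainPO.CPOC.isGroupoid.ι ∧
      ChainPO.RestrictToIso C S
        (inducedFunctor ChainPO.PRestriction.toDRS : ChainPO.PRestrictionCat.{u} ⥤ ChainPO.DRS.{u})
        ChainPO.CPOC.isSymmetric.ι ∧
      ChainPO.RestrictToIso C S
        (inducedFunctor ChainPO.RegularCirc.toDRS : ChainPO.RegularCircCat.{u} ⥤ ChainPO.DRS.{u})
        ChainPO.CPOC.isSymmetricGroupoid.ι ∧
      ChainPO.RestrictToIso C S
        (inducedFunctor ChainPO.Restriction.toDRS : ChainPO.RestrictionCat.{u} ⥤ ChainPO.DRS.{u})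
        ChainPO.CPOC.isCommutative.ι ∧
      ChainPO.RestrictToIso C S
        (inducedFunctor ChainPO.Inverse.toDRS : ChainPO.InverseCat.{u} ⥤ ChainPO.DRS.{u})
        ChainPO.CPOC.isCommutativeGroupoid.ι :=
  open ChainPO in
  ⟨toCPOC, toDRS, toCPOC_toDRS, rfl, rfl, isChainCatOf_toCPOC, isSemigroupOf_toDRS,
    toCPOC_toDRS.restrictToIso GenRegularCirc.toDRS_injective isGroupoid_toCPOC_iff,
    toCPOC_toDRS.restrictToIso PRestriction.toDRS_injective isSymmetric_toCPOC_iff,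
    toCPOC_toDRS.restrictToIso RegularCirc.toDRS_injective isSymmetricGroupoid_toCPOC_iff,
    toCPOC_toDRS.restrictToIso Restriction.toDRS_injective isCommutative_toCPOC_iff,
    toCPOC_toDRS.restrictToIso Inverse.toDRS_injective isCommutativeGroupoid_toCPOC_iff⟩
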